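/- A \emph{skew monoidal category} is a category $\mathcal C$ with a functor $\otimes\colon\mathcal C\times\mathcal C\to\mathcal C$, an object $i$ and natural (not necessarily invertible) maps $\alpha\colon(a\otimes b)\otimes c\to a\otimes(b\otimes c)$, $\lambda\colon i\otimes a\to a$, $\rho\colon a\to a\otimes i$ such that, for all $a,b,c,d$, \begin{gather*} (1_a\otimes\alpha_{b,c,d})\,\alpha_{a,b\otimes c,d}\,(\alpha_{a,b,c}\otimes 1_d)=\alpha_{a,b,c\otimes d}\,\alpha_{a\otimes b,c,d},\\ \lambda_{a\otimes b}\,\alpha_{i,a,b}=\lambda_a\otimes 1_b,\qquad (1_a\otimes\lambda_b)\,\alpha_{a,i,b}\,(\rho_a\otimes 1_b)=1_{a\otimes b},\\ \alpha_{a,b,i}\,\rho_{a\otimes b}=1_a\otimes\rho_b,\qquad \lambda_i\,\rho_i=1_i . \end{gather*} It is \emph{left normal} if every $\lambda_a\colon i\otimes a\to a$ is invertible. Left normal skew monoidal categories, lax monoidal functors and monoidal natural transformations form a 2-category. A \emph{multicategory} $\mathbb A$ has objects, a set $\mathbb A(a_1,\dots,a_n;b)$ of multimaps for each (possibly empty)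 list of objects $a_1,\dots,a_n$ and each object $b$, identities $1_a\in\mathbb A(a;a)$, and a substitution operation $(g,f_1,\dots,f_n)\mapsto g(f_1,\dots,f_n)$, subject to the associativity and identity laws. A morphism $F$ of multicategories maps objects to objects and $\mathbb A(a_1,\dots,a_n;b)$ to $\mathbb B(Fa_1,\dots,Fa_n;Fb)$, preserving identities and substitution. A 2-cell $\varphi\colon F\to G$ consists of unary multimaps $\varphi_a\in\mathbb B(Fa;Ga)$ such that $\varphi_b(Ff)=(Gf)(\varphi_{a_1},\dots,\varphi_{a_n})$ for all $f\in\mathbb A(a_1,\dots,a_n;b)$. These form a 2-category. A \emph{skew multicategory} $\mathbb A$ consists of a multicategory $\mathbb A_\ell$ of ``loose'' multimaps together with, for each $n>0$, sets $\mathbb A_t(a_1,\dots,a_n;b)$ of ``tight'' multimaps and functions $j\colon\mathbb A_t(a_1,\dots,a_n;b)\to\mathbb A_\ell(a_1,\dots,a_n;b)$, with tight identities and substitutions $g(f_1,\dots,f_n)$ which are tight when $g$ and $f_1$ are tight (and loose otherwise), compatible with $j$ and satisfying the associativity and identity laws. For $x\in\{t,\ell\}$ and a list $\overline a$ (non-empty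 if $x=t$), a multimap $\theta\in\mathbb A_x(\overline a;m)$ is \emph{universal} if $-\circ_1\theta\colon\mathbb A_t(m;c)\to\mathbb A_x(\overline a;c)$ is a bijection for all $c$, and \emph{left universal} if $-\circ_1\theta\colon\mathbb A_t(m,\overline b;c)\to\mathbb A_x(\overline a,\overline b;c)$ is a bijection for all lists $\overline b$ and all $c$, where $g\circ_1\theta=g(\theta,1,\dots,1)$. The skew multicategory $\mathbb A$ is \emph{left representable} if for all such $x$ and $\overline a$ there is a universal $\theta\in\mathbb A_x(\overline a;m)$ for some $m$, and every universal multimap is left universal. A multicategory is \emph{left representable} if it is so when viewed as the skew multicategory all of whose multimaps are tight (that is, $\mathbb A_t(\overline a;b)=\mathbb A_\ell(\overline a;b)=\mathbb A(\overline a;b)$ for non-empty $\overline a$, with $j$ the identity). \textbf{Theorem.} There is a 2-equivalence between the 2-category of left normal skew monoidal categories, lax monoidal functors and monoidal natural transformations, and the full sub-2-category of the 2-category of multicategories consisting of the left representable multicategories. (A 2-equivalence consists of strict 2-functors in both directions whose two composites are 2-naturally isomorphic to the identities.) -/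

import Mathlib

universe v u w₁ w₂ v₁ v₂ u₁ u₂

namespace SkewMult

open CategoryTheory

/-! ## Skew monoidal categories -/

/-- A skew monoidal structure on a category: a tensor product functor in two variables, a unit
object and (not necessarily invertible) natural maps
`α : (a ⊗ b) ⊗ c ⟶ a ⊗ (b ⊗ c)`, `lam : i ⊗ a ⟶ a`, `rho : a ⟶ a ⊗ i`
subject to the five axioms of Szlachányi. -/
class SkewMonoidal (C : Type u) [Category.{v} C] where
  tensor : C → C → C
  unit : C
  tensorHom {a a' b b' : C} (f : a ⟶ a') (g : b ⟶ b') : tensor a b ⟶ tensor a' b'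
  tensorHom_id (a b : C) : tensorHom (𝟙 a) (𝟙 b) = 𝟙 (tensor a b)
  tensorHom_comp {a a' a'' b b' b'' : C} (f : a ⟶ a') (f' : a' ⟶ a'') (g : b ⟶ b')
    (g' : b' ⟶ b'') : tensorHom (f ≫ f') (g ≫ g') = tensorHom f g ≫ tensorHom f' g'
  α (a b c : C) : tensor (tensor a b) c ⟶ tensor a (tensor b c)
  lam (a : C) : tensor unit a ⟶ a
  rho (a : C) : a ⟶ tensor a unit
  α_naturality {a a' b b' c c' : C} (f : a ⟶ a') (g : b ⟶ b') (h : c ⟶ c') :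
    tensorHom (tensorHom f g) h ≫ α a' b' c' = α a b c ≫ tensorHom f (tensorHom g h)
  lam_naturality {a a' : C} (f : a ⟶ a') : tensorHom (𝟙 unit) f ≫ lam a' = lam a ≫ f
  rho_naturality {a a' : C} (f : a ⟶ a') : f ≫ rho a' = rho a ≫ tensorHom f (𝟙 unit)
  pentagon (a b c d : C) :
    tensorHom (α a b c) (𝟙 d) ≫ α a (tensor b c) d ≫ tensorHom (𝟙 a) (α b c d) =
      α (tensor a b) c d ≫ α a b (tensor c d)
  α_lam (a b : C) : α unit a b ≫ lam (tensor a b) = tensorHom (lam a) (𝟙 b)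
  triangle (a b : C) :
    tensorHom (rho a) (𝟙 b) ≫ α a unit b ≫ tensorHom (𝟙 a) (lam b) = 𝟙 (tensor a b)
  rho_α (a b : C) : rho (tensor a b) ≫ α a b unit = tensorHom (𝟙 a) (rho b)
  rho_lam : rho unit ≫ lam unit = 𝟙 unit

/-- A (bundled) skew monoidal category. -/
structure SkewMonCat where
  carrier : Type u
  [category : Category.{v} carrier]
  [skewMonoidal : SkewMonoidal carrier]

attribute [instance] SkewMonCat.category SkewMonCat.skewMonoidal

open SkewMonoidal

/-- A lax monoidal functor between skew monoidal categories. -/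
structure LaxMonFunctor (C D : SkewMonCat.{v, u}) where
  functor : C.carrier ⥤ D.carrier
  ε : (unit : D.carrier) ⟶ functor.obj unit
  μ (a b : C.carrier) : tensor (functor.obj a) (functor.obj b) ⟶ functor.obj (tensor a b)
  μ_naturality {a a' b b' : C.carrier} (f : a ⟶ a') (g : b ⟶ b') :
    tensorHom (functor.map f) (functor.map g) ≫ μ a' b' = μ a b ≫ functor.map (tensorHom f g)
  associativity (a b c : C.carrier) :
    tensorHom (μ a b) (𝟙 (functor.obj c)) ≫ μ (tensor a b) c ≫ functor.map (α a b c) =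
      α (functor.obj a) (functor.obj b) (functor.obj c) ≫
        tensorHom (𝟙 (functor.obj a)) (μ b c) ≫ μ a (tensor b c)
  left_unitality (a : C.carrier) :
    tensorHom ε (𝟙 (functor.obj a)) ≫ μ unit a ≫ functor.map (lam a) = lam (functor.obj a)
  right_unitality (a : C.carrier) :
    rho (functor.obj a) ≫ tensorHom (𝟙 (functor.obj a)) ε ≫ μ a unit = functor.map (rho a)

/-- A monoidal natural transformation between lax monoidal functors. -/
@[ext]
structure MonNatTrans {C D : SkewMonCat.{v, u}} (F G : LaxMonFunctor C D) where
  trans : F.functor ⟶ G.functor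
  unit_app : F.ε ≫ trans.app unit = G.ε
  tensor_app (a b : C.carrier) :
    F.μ a b ≫ trans.app (tensor a b) = tensorHom (trans.app a) (trans.app b) ≫ G.μ a b

/-- The identity lax monoidal functor. -/
@[simps]
def LaxMonFunctor.id (C : SkewMonCat.{v, u}) : LaxMonFunctor C C where
  functor := 𝟭 C.carrier
  ε := 𝟙 _
  μ a b := 𝟙 _
  μ_naturality f g := by simp
  associativity a b c := by simp [tensorHom_id]
  left_unitality a := by simp [tensorHom_id]
  right_unitality a := by simp [tensorHom_id]

theorem tensorHom_split {C : Type u} [Category.{v} C] [SkewMonoidal C] {a a' a'' b : C}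
    (f : a ⟶ a') (g : a' ⟶ a'') :
    tensorHom (f ≫ g) (𝟙 b) = tensorHom f (𝟙 b) ≫ tensorHom g (𝟙 b) := by
  rw [← tensorHom_comp, Category.comp_id]

theorem tensorHom_split' {C : Type u} [Category.{v} C] [SkewMonoidal C] {a b b' b'' : C}
    (f : b ⟶ b') (g : b' ⟶ b'') :
    tensorHom (𝟙 a) (f ≫ g) = tensorHom (𝟙 a) f ≫ tensorHom (𝟙 a) g := by
  rw [← tensorHom_comp, Category.comp_id]

/-- Composition of lax monoidal functors. -/
@[simps]
def LaxMonFunctor.comp {C D E : SkewMonCat.{v, u}} (F : LaxMonFunctor C D)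
    (G : LaxMonFunctor D E) : LaxMonFunctor C E where
  functor := F.functor ⋙ G.functor
  ε := G.ε ≫ G.functor.map F.ε
  μ a b := G.μ (F.functor.obj a) (F.functor.obj b) ≫ G.functor.map (F.μ a b)
  μ_naturality f g := by
    simp only [Functor.comp_map, Functor.comp_obj, Category.assoc]
    rw [reassoc_of% G.μ_naturality, ← Functor.map_comp, F.μ_naturality, Functor.map_comp]
  associativity a b c := by
    simp only [Functor.comp_map, Functor.comp_obj, Category.assoc]
    have h1 := G.μ_naturality (F.μ a b) (𝟙 (F.functor.obj c))
    have h2 := G.μ_naturality (𝟙 (F.functor.obj a)) (F.μ b c)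
    rw [CategoryTheory.Functor.map_id] at h1 h2
    rw [tensorHom_split, tensorHom_split', Category.assoc, reassoc_of% h1, Category.assoc,
      reassoc_of% h2, ← G.functor.map_comp, ← G.functor.map_comp, F.associativity,
      G.functor.map_comp, reassoc_of% G.associativity, G.functor.map_comp]
  left_unitality a := by
    simp only [Functor.comp_map, Functor.comp_obj, Category.assoc]
    have h1 := G.μ_naturality F.ε (𝟙 (F.functor.obj a))
    rw [CategoryTheory.Functor.map_id] at h1
    rw [tensorHom_split, Category.assoc, reassoc_of% h1, ← G.functor.map_comp,
      ← G.functor.map_comp, F.left_unitality, G.left_unitality]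
  right_unitality a := by
    simp only [Functor.comp_map, Functor.comp_obj]
    have h1 := G.μ_naturality (𝟙 (F.functor.obj a)) F.ε
    rw [CategoryTheory.Functor.map_id] at h1
    have h2 := G.right_unitality (F.functor.obj a)
    rw [tensorHom_split', Category.assoc, reassoc_of% h1, ← F.right_unitality,
      G.functor.map_comp, ← h2]
    simp only [Category.assoc, Functor.map_comp]

instance : CategoryStruct SkewMonCat.{v, u} where
  Hom C D := LaxMonFunctor C D
  id C := LaxMonFunctor.id C
  comp F G := LaxMonFunctor.comp F G

instance (C D : SkewMonCat.{v, u}) : Category (C ⟶ D) where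
  Hom F G := MonNatTrans F G
  id F := { trans := 𝟙 F.functor
            unit_app := by simp
            tensor_app := fun a b => by simp [tensorHom_id] }
  comp φ ψ := { trans := φ.trans ≫ ψ.trans
                unit_app := by simp [reassoc_of% φ.unit_app, ψ.unit_app]
                tensor_app := fun a b => by
                  simp [reassoc_of% φ.tensor_app, ψ.tensor_app, tensorHom_comp] }
  id_comp φ := MonNatTrans.ext (Category.id_comp φ.trans)
  comp_id φ := MonNatTrans.ext (Category.comp_id φ.trans)
  assoc φ ψ χ := MonNatTrans.ext (Category.assoc φ.trans ψ.trans χ.trans)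

/-- Two lax monoidal functors with the same underlying functor and structure maps are equal. -/
theorem LaxMonFunctor.eq_of {C D : SkewMonCat.{v, u}} {F G : LaxMonFunctor C D}
    (h : F.functor = G.functor) (hε : F.ε ≍ G.ε) (hμ : ∀ a b, F.μ a b ≍ G.μ a b) : F = G := by
  cases F
  cases G
  dsimp only at h
  subst h
  dsimp only at hε hμ
  obtain rfl := eq_of_heq hε
  congr
  funext a b
  exact eq_of_heq (hμ a b)

@[ext]
theorem SkewMonCat.hom₂_ext {C D : SkewMonCat.{v, u}} {F G : C ⟶ D} {φ ψ : F ⟶ G}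
    (h : ∀ a, φ.trans.app a = ψ.trans.app a) : φ = ψ :=
  MonNatTrans.ext (NatTrans.ext (funext h))

section

variable {C D E : SkewMonCat.{v, u}}

@[simp] theorem SkewMonCat.id_functor : LaxMonFunctor.functor (𝟙 C) = 𝟭 C.carrier := rfl
@[simp] theorem SkewMonCat.comp_functor (F : C ⟶ D) (G : D ⟶ E) :
    (F ≫ G).functor = F.functor ⋙ G.functor := rfl
@[simp] theorem SkewMonCat.id_ε : LaxMonFunctor.ε (𝟙 C) = 𝟙 _ := rfl
@[simp] theorem SkewMonCat.comp_ε (F : C ⟶ D) (G : D ⟶ E) :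
    (F ≫ G).ε = G.ε ≫ G.functor.map F.ε := rfl
@[simp] theorem SkewMonCat.id_μ (a b : C.carrier) : LaxMonFunctor.μ (𝟙 C) a b = 𝟙 _ := rfl
@[simp] theorem SkewMonCat.comp_μ (F : C ⟶ D) (G : D ⟶ E) (a b : C.carrier) :
    (F ≫ G).μ a b =
      G.μ (F.functor.obj a) (F.functor.obj b) ≫ G.functor.map (F.μ a b) := rfl
@[simp] theorem SkewMonCat.id_trans (F : C ⟶ D) : MonNatTrans.trans (𝟙 F) = 𝟙 F.functor := rfl
@[simp] theorem SkewMonCat.comp_trans {F G H : C ⟶ D} (φ : F ⟶ G) (ψ : G ⟶ H) :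
    (φ ≫ ψ).trans = φ.trans ≫ ψ.trans := rfl

/-- Whiskering of a monoidal transformation on the left. -/
@[simps]
def MonNatTrans.whiskerLeft (F : C ⟶ D) {G H : D ⟶ E} (ψ : G ⟶ H) :
    MonNatTrans (F ≫ G) (F ≫ H) where
  trans := Functor.whiskerLeft F.functor ψ.trans
  unit_app := by
    have h1 := ψ.unit_app
    have h2 := ψ.trans.naturality F.ε
    simp only [SkewMonCat.comp_functor, SkewMonCat.comp_ε, Functor.whiskerLeft_app,
      Category.assoc, h2, reassoc_of% h1]
  tensor_app a b := by
    have h1 := ψ.tensor_app (F.functor.obj a) (F.functor.obj b)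
    have h2 := ψ.trans.naturality (F.μ a b)
    simp only [SkewMonCat.comp_functor, SkewMonCat.comp_μ, Functor.whiskerLeft_app,
      Category.assoc, h2, reassoc_of% h1]

/-- Whiskering of a monoidal transformation on the right. -/
@[simps]
def MonNatTrans.whiskerRight {F G : C ⟶ D} (φ : F ⟶ G) (H : D ⟶ E) :
    MonNatTrans (F ≫ H) (G ≫ H) where
  trans := Functor.whiskerRight φ.trans H.functor
  unit_app := by
    simp only [SkewMonCat.comp_functor, SkewMonCat.comp_ε, Functor.whiskerRight_app,
      Category.assoc, ← Functor.map_comp, φ.unit_app]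
  tensor_app a b := by
    have h1 := H.μ_naturality (φ.trans.app a) (φ.trans.app b)
    simp only [SkewMonCat.comp_functor, SkewMonCat.comp_μ, Functor.whiskerRight_app,
      Category.assoc, ← Functor.map_comp, φ.tensor_app]
    simp only [Functor.map_comp, reassoc_of% h1]

/-- A monoidal transformation with invertible underlying transformation is invertible. -/
@[simps]
def MonNatTrans.isoMk {F G : C ⟶ D} (t : F.functor ≅ G.functor)
    (h : F.ε ≫ t.hom.app unit = G.ε)
    (h' : ∀ a b, F.μ a b ≫ t.hom.app (tensor a b) =
      tensorHom (t.hom.app a) (t.hom.app b) ≫ G.μ a b) : F ≅ G where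
  hom := { trans := t.hom
           unit_app := h
           tensor_app := h' }
  inv := { trans := t.inv
           unit_app := by simp [← h]
           tensor_app := fun a b => by
             have e := congrArg (fun k => tensorHom (t.inv.app a) (t.inv.app b) ≫ k ≫
               t.inv.app (tensor a b)) (h' a b)
             simp only [Category.assoc, Iso.hom_inv_id_app, Category.comp_id] at e
             rw [e, ← Category.assoc, ← tensorHom_comp]
             simp [tensorHom_id] }
  hom_inv_id := by ext; simp
  inv_hom_id := by ext; simp

theorem SkewMonCat.eq_eqToIso {F G : C ⟶ D} (i : F ≅ G) (e : F = G)
    (h : ∀ a, i.hom.trans.app a ≍ 𝟙 (F.functor.obj a)) : i = eqToIso e := by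
  subst e
  ext a
  exact eq_of_heq (h a)

end

instance : Bicategory SkewMonCat.{v, u} where
  whiskerLeft F _ _ ψ := MonNatTrans.whiskerLeft F ψ
  whiskerRight φ H := MonNatTrans.whiskerRight φ H
  associator F G H := MonNatTrans.isoMk (F := (F ≫ G) ≫ H) (G := F ≫ G ≫ H)
    (Functor.associator F.functor G.functor H.functor) (by simp) (by simp [tensorHom_id])
  leftUnitor {C D} F := MonNatTrans.isoMk (F := 𝟙 C ≫ F) (G := F) F.functor.leftUnitor
    (by simp) (by simp [tensorHom_id])
  rightUnitor {C D} F := MonNatTrans.isoMk (F := F ≫ 𝟙 D) (G := F) F.functor.rightUnitor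
    (by simp) (by simp [tensorHom_id])
  id_whiskerLeft η := by
    ext a
    exact ((Category.id_comp _).trans (Category.comp_id (η.trans.app a))).symm
  comp_whiskerLeft F G _ _ η := by
    ext a
    exact ((Category.id_comp _).trans
      (Category.comp_id (η.trans.app (G.functor.obj (F.functor.obj a))))).symm
  whiskerRight_id η := by
    ext a
    exact ((Category.id_comp _).trans (Category.comp_id (η.trans.app a))).symm
  whiskerRight_comp η G H := by
    ext a
    exact ((Category.id_comp _).trans
      (Category.comp_id (H.functor.map (G.functor.map (η.trans.app a))))).symm
  whisker_assoc F _ _ η H := by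
    ext a
    exact ((Category.id_comp _).trans
      (Category.comp_id (H.functor.map (η.trans.app (F.functor.obj a))))).symm
  pentagon F G H I := by
    ext a
    exact (congrArg (· ≫ 𝟙 _ ≫ 𝟙 _)
      (I.functor.map_id (H.functor.obj (G.functor.obj (F.functor.obj a))))).trans
        (Category.id_comp _)
  triangle F G := by
    ext a
    exact (Category.id_comp _).trans (G.functor.map_id (F.functor.obj a)).symm

instance : Bicategory.Strict SkewMonCat.{v, u} where
  id_comp {C D} F := LaxMonFunctor.eq_of (F := 𝟙 C ≫ F) rfl
    (heq_of_eq ((congrArg (F.ε ≫ ·) (F.functor.map_id _)).trans (Category.comp_id _)))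
    (fun a b => heq_of_eq
      ((congrArg (F.μ a b ≫ ·) (F.functor.map_id _)).trans (Category.comp_id _)))
  comp_id {C D} F := LaxMonFunctor.eq_of (F := F ≫ 𝟙 D) rfl
    (heq_of_eq (Category.id_comp F.ε)) (fun a b => heq_of_eq (Category.id_comp (F.μ a b)))
  assoc F G H := LaxMonFunctor.eq_of (F := (F ≫ G) ≫ H) (G := F ≫ G ≫ H) rfl
    (heq_of_eq (by simp)) (fun a b => heq_of_eq (by simp))
  leftUnitor_eqToIso F := SkewMonCat.eq_eqToIso _ _ fun _ => HEq.rfl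
  rightUnitor_eqToIso F := SkewMonCat.eq_eqToIso _ _ fun _ => HEq.rfl
  associator_eqToIso F G H := SkewMonCat.eq_eqToIso _ _ fun _ => HEq.rfl

/-! ## Multicategories -/

/-- For a family of multihom sets `Hom as b`, an element of `HomList Hom as bs`, where
`bs = [b₁, …, bₙ]`, is a decomposition of `as` as a concatenation of lists `as₁, …, asₙ` (each
possibly empty) together with a multimap `fᵢ` in `Hom asᵢ bᵢ` for each `i`. -/
inductive HomList {A : Type u} (Hom : List A → A → Type v) : List A → List A → Type (max u v)
  | nil : HomList Hom [] []
  | cons {as as₁ as₂ : List A} {b : A} {bs : List A} (h : as = as₁ ++ as₂) (f : Hom as₁ b)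
      (fs : HomList Hom as₂ bs) : HomList Hom as (b :: bs)

namespace HomList

variable {A : Type u} {Hom : List A → A → Type v}

/-- The one-element list consisting of `f`. -/
def single {as : List A} {b : A} (f : Hom as b) : HomList Hom as [b] :=
  cons (List.append_nil as).symm f nil

/-- The list `(f a₁, …, f aₙ)` of unary multimaps. -/
def unary {I : Type u₁} {F G : I → A} (f : ∀ a, Hom [F a] (G a)) :
    ∀ as : List I, HomList Hom (as.map F) (as.map G)
  | [] => nil
  | a :: as => cons (as₁ := [F a]) rfl (f a) (unary f as)

/-- The list `(1, …, 1)` of identities. -/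
def ones (one : ∀ a, Hom [a] a) : ∀ as : List A, HomList Hom as as
  | [] => nil
  | a :: as => cons (as₁ := [a]) rfl (one a) (ones one as)

/-- The two parts into which a list of multimaps with targets `bs₁ ++ bs₂` is cut. -/
structure Splitting (Hom : List A → A → Type v) (as bs₁ bs₂ : List A) where
  left : List A
  right : List A
  eq : as = left ++ right
  fst : HomList Hom left bs₁
  snd : HomList Hom right bs₂

/-- Cut a list of multimaps with targets `bs₁ ++ bs₂` into two parts. -/
def split : ∀ {as : List A} (bs₁ : List A) {bs₂ : List A}, HomList Hom as (bs₁ ++ bs₂) →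
    Splitting Hom as bs₁ bs₂
  | as, [], _, fs => ⟨[], as, rfl, nil, fs⟩
  | _, _ :: bs₁, _, cons (as₁ := as₁) h f fs =>
    ⟨as₁ ++ (split bs₁ fs).left, (split bs₁ fs).right,
      by rw [h, List.append_assoc, ← (split bs₁ fs).eq], cons rfl f (split bs₁ fs).fst,
      (split bs₁ fs).snd⟩

/-- Given a substitution operation `comp`, the list `(g₁(f₁₁, …), …, gₙ(fₙ₁, …))` obtained by
substituting the list `f₁₁, …, fₙₖ` in the multimaps `g₁, …, gₙ`. -/
def subst (comp : ∀ {as bs : List A} {c : A}, Hom bs c → HomList Hom as bs → Hom as c) :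
    ∀ {as bs cs : List A}, HomList Hom bs cs → HomList Hom as bs → HomList Hom as cs
  | _, _, _, nil, fs => fs
  | _, _, _, cons (as₁ := bs₁) h g gs, fs =>
    cons (split bs₁ (h ▸ fs)).eq (comp g (split bs₁ (h ▸ fs)).fst)
      (subst comp gs (split bs₁ (h ▸ fs)).snd)

/-- Apply an operation on multimaps to each member of a list. -/
def map {B : Type u₁} {Hom' : List B → B → Type v₁} (obj : A → B)
    (m : ∀ {as : List A} {b : A}, Hom as b → Hom' (as.map obj) (obj b)) :
    ∀ {as bs : List A}, HomList Hom as bs → HomList Hom' (as.map obj) (bs.map obj)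
  | _, _, nil => nil
  | _, _, cons h f fs => cons (by rw [h, List.map_append]) (m f) (map obj m fs)

theorem cons_heq {as as' as₁ as₁' as₂ as₂' : List A} {b b' : A} {bs bs' : List A}
    {h : as = as₁ ++ as₂} {h' : as' = as₁' ++ as₂'} {f : Hom as₁ b} {f' : Hom as₁' b'}
    {fs : HomList Hom as₂ bs} {fs' : HomList Hom as₂' bs'} (e₁ : as₁ = as₁') (e₂ : as₂ = as₂')
    (eb : b = b') (ebs : bs = bs') (hf : f ≍ f') (hfs : fs ≍ fs') :
    cons h f fs ≍ cons h' f' fs' := by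
  subst e₁ e₂ eb ebs h h'
  rw [eq_of_heq hf, eq_of_heq hfs]

theorem single_heq {as as' : List A} {b b' : A} {f : Hom as b} {f' : Hom as' b'} (e : as = as')
    (eb : b = b') (hf : f ≍ f') : single f ≍ single f' := by
  subst e eb
  rw [eq_of_heq hf]

theorem split_append_nil : ∀ {as : List A} (bs : List A) (fs : HomList Hom as (bs ++ [])),
    (split bs fs).left = as ∧ (split bs fs).right = [] ∧ (split bs fs).fst ≍ fs ∧
      (split bs fs).snd ≍ (nil : HomList Hom [] [])
  | _, [], nil => ⟨rfl, rfl, HEq.rfl, HEq.rfl⟩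
  | _, _ :: bs, cons h f fs => by
    obtain ⟨h₁, h₂, h₃, h₄⟩ := split_append_nil bs fs
    exact ⟨by simp only [split]; rw [h₁, h], h₂,
      cons_heq rfl h₁ rfl (List.append_nil bs).symm HEq.rfl h₃, h₄⟩

theorem unary_heq {I : Type u₁} {J : Type u₂} {F G : J → A} (k : I → J)
    (f : ∀ a, Hom [F a] (G a)) (as : List I) :
    unary (F := fun a => F (k a)) (G := fun a => G (k a)) (fun a => f (k a)) as ≍
      unary f (as.map k) := by
  induction as with
  | nil => exact HEq.rfl
  | cons a as ih => exact cons_heq rfl (by simp) rfl (by simp) HEq.rfl ih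

theorem unary_one (one : ∀ a, Hom [a] a) {I : Type u₁} (F : I → A) (as : List I) :
    unary (F := F) (G := F) (fun a => one (F a)) as = ones one (as.map F) := by
  induction as with
  | nil => rfl
  | cons a as ih => exact congrArg (cons (as₁ := [F a]) rfl (one (F a))) ih

end HomList

/-- A multicategory. -/
structure Multicategory where
  Obj : Type u
  Hom : List Obj → Obj → Type v
  one (a : Obj) : Hom [a] a
  /-- Substitution: `comp g (f₁, …, fₙ)` is `g(f₁, …, fₙ)`. -/
  comp {as bs : List Obj} {c : Obj} (g : Hom bs c) (fs : HomList Hom as bs) : Hom as c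
  one_comp {as : List Obj} {c : Obj} (g : Hom as c) : comp (one c) (.single g) = g
  comp_one {bs : List Obj} {c : Obj} (g : Hom bs c) : comp g (.ones one bs) = g
  assoc {as bs cs : List Obj} {d : Obj} (h : Hom cs d) (gs : HomList Hom bs cs)
    (fs : HomList Hom as bs) : comp (comp h gs) fs = comp h (gs.subst comp fs)

namespace Multicategory

variable (M : Multicategory.{v, u})

theorem comp_heq {as as' bs bs' : List M.Obj} {c c' : M.Obj} {g : M.Hom bs c} {g' : M.Hom bs' c'}
    {fs : HomList M.Hom as bs} {fs' : HomList M.Hom as' bs'} (ha : as = as') (hb : bs = bs')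
    (hc : c = c') (hg : g ≍ g') (hf : fs ≍ fs') : M.comp g fs ≍ M.comp g' fs' := by
  subst ha hb hc
  rw [eq_of_heq hg, eq_of_heq hf]

theorem subst_single {as bs : List M.Obj} {c : M.Obj} (g : M.Hom bs c)
    (fs : HomList M.Hom as bs) :
    (HomList.single g).subst M.comp fs = HomList.single (M.comp g fs) := by
  have e := (List.append_nil bs).symm
  obtain ⟨h₁, h₂, h₃, h₄⟩ := HomList.split_append_nil bs (e ▸ fs)
  exact eq_of_heq (HomList.cons_heq h₁ h₂ rfl rfl
    (M.comp_heq h₁ rfl rfl HEq.rfl (h₃.trans (eqRec_heq _ _))) h₄)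

theorem subst_unary {I : Type u₁} {F G H : I → M.Obj} (ψ : ∀ a, M.Hom [G a] (H a))
    (φ : ∀ a, M.Hom [F a] (G a)) (as : List I) :
    (HomList.unary ψ as).subst M.comp (HomList.unary φ as) =
      HomList.unary (fun a => M.comp (ψ a) (.single (φ a))) as := by
  induction as with
  | nil => rfl
  | cons a as ih =>
    exact congrArg (HomList.cons (as₁ := [F a]) rfl (M.comp (ψ a) (.single (φ a)))) ih

/-- Transport of a multimap along an equality of lists of objects. -/
def castDom {as bs : List M.Obj} {c : M.Obj} (h : as = bs) (f : M.Hom as c) : M.Hom bs c :=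
  h ▸ f

theorem castDom_heq {as bs : List M.Obj} {c : M.Obj} (h : as = bs) (f : M.Hom as c) :
    M.castDom h f ≍ f := by
  subst h
  rfl

end Multicategory

/-- A morphism of multicategories. -/
structure MultiFunctor (M N : Multicategory.{v, u}) where
  obj : M.Obj → N.Obj
  map {as : List M.Obj} {b : M.Obj} : M.Hom as b → N.Hom (as.map obj) (obj b)
  map_one (a : M.Obj) : map (M.one a) = N.one (obj a)
  map_comp {as bs : List M.Obj} {c : M.Obj} (g : M.Hom bs c) (fs : HomList M.Hom as bs) :
    map (M.comp g fs) = N.comp (map g) (fs.map obj map)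

namespace MultiFunctor

theorem eq_of {M N : Multicategory.{v, u}} {F G : MultiFunctor M N} (h : F.obj = G.obj)
    (h' : ∀ (as : List M.Obj) (b : M.Obj) (f : M.Hom as b), F.map f ≍ G.map f) : F = G := by
  cases F
  cases G
  dsimp only at h
  subst h
  congr
  funext as b f
  exact eq_of_heq (h' as b f)

theorem map_heq {M N : Multicategory.{v, u}} (F : MultiFunctor M N) {as as' : List M.Obj}
    {b b' : M.Obj} {f : M.Hom as b} {f' : M.Hom as' b'} (h : as = as') (hb : b = b')
    (hf : f ≍ f') : F.map f ≍ F.map f' := by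
  subst h hb
  rw [eq_of_heq hf]

/-- The identity morphism. -/
def id (M : Multicategory.{v, u}) : MultiFunctor M M where
  obj a := a
  map f := M.castDom (List.map_id' _).symm f
  map_one a := rfl
  map_comp {as bs c} g fs := by
    apply eq_of_heq
    refine (M.castDom_heq _ _).trans (M.comp_heq (List.map_id' _).symm (List.map_id' _).symm rfl
      (M.castDom_heq _ _).symm ?_)
    clear g
    induction fs with
    | nil => exact HEq.rfl
    | cons h f fs ih =>
      exact HomList.cons_heq (List.map_id' _).symm (List.map_id' _).symm rfl
        (List.map_id' _).symm (M.castDom_heq _ _).symm ih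

/-- Composition of morphisms of multicategories. -/
def comp {M N P : Multicategory.{v, u}} (F : MultiFunctor M N) (G : MultiFunctor N P) :
    MultiFunctor M P where
  obj a := G.obj (F.obj a)
  map f := P.castDom List.map_map (G.map (F.map f))
  map_one a := by
    rw [F.map_one, G.map_one]
    rfl
  map_comp {as bs c} g fs := by
    apply eq_of_heq
    rw [F.map_comp, G.map_comp]
    refine (P.castDom_heq _ _).trans (P.comp_heq List.map_map List.map_map rfl
      (P.castDom_heq _ _).symm ?_)
    clear g
    induction fs with
    | nil => exact HEq.rfl
    | cons h f fs ih =>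
      exact HomList.cons_heq List.map_map List.map_map rfl List.map_map
        (P.castDom_heq _ _).symm ih

end MultiFunctor

/-- A 2-cell between morphisms of multicategories. -/
@[ext]
structure MultiTrans {M N : Multicategory.{v, u}} (F G : MultiFunctor M N) where
  app (a : M.Obj) : N.Hom [F.obj a] (G.obj a)
  naturality {as : List M.Obj} {b : M.Obj} (f : M.Hom as b) :
    N.comp (app b) (.single (F.map f)) = N.comp (G.map f) (.unary app as)

instance : CategoryStruct Multicategory.{v, u} where
  Hom M N := MultiFunctor M N
  id M := MultiFunctor.id M
  comp F G := MultiFunctor.comp F G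

namespace Multicategory

variable {M N P : Multicategory.{v, u}}

instance (M N : Multicategory.{v, u}) : Category (M ⟶ N) where
  Hom F G := MultiTrans F G
  id F :=
    { app := fun a => N.one (F.obj a)
      naturality := fun {as b} f => by
        rw [N.one_comp, HomList.unary_one N.one F.obj as, N.comp_one] }
  comp {F G H} φ ψ :=
    { app := fun a => N.comp (ψ.app a) (.single (φ.app a))
      naturality := fun {as b} f => by
        rw [N.assoc, subst_single, φ.naturality, ← subst_single, ← N.assoc, ψ.naturality,
          N.assoc, subst_unary] }
  id_comp {F G} φ := MultiTrans.ext (funext fun a => N.comp_one (φ.app a))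
  comp_id {F G} φ := MultiTrans.ext (funext fun a => N.one_comp (φ.app a))
  assoc {F G H K} φ ψ χ := MultiTrans.ext (funext fun a => by
    dsimp only
    rw [N.assoc, subst_single])

@[ext]
theorem hom₂_ext {F G : M ⟶ N} {φ ψ : F ⟶ G} (h : ∀ a, φ.app a = ψ.app a) : φ = ψ :=
  MultiTrans.ext (funext h)

@[simp] theorem id_app (F : M ⟶ N) (a : M.Obj) : MultiTrans.app (𝟙 F) a = N.one (F.obj a) := rfl
@[simp] theorem comp_app {F G H : M ⟶ N} (φ : F ⟶ G) (ψ : G ⟶ H) (a : M.Obj) :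
    (φ ≫ ψ).app a = N.comp (ψ.app a) (.single (φ.app a)) := rfl

theorem map_comp_obj (F : M ⟶ N) (G : N ⟶ P) (as : List M.Obj) :
    as.map (F ≫ G).obj = (as.map F.obj).map G.obj :=
  (List.map_map (g := G.obj) (f := F.obj)).symm

/-- Whiskering of a 2-cell on the left. -/
def whiskerLeft (F : M ⟶ N) {G H : N ⟶ P} (ψ : G ⟶ H) : MultiTrans (F ≫ G) (F ≫ H) where
  app a := ψ.app (F.obj a)
  naturality {as b} f := by
    apply eq_of_heq
    refine HEq.trans ?_ ((heq_of_eq (ψ.naturality (F.map f))).trans ?_)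
    · exact P.comp_heq (map_comp_obj _ _ _) rfl rfl HEq.rfl
        (HomList.single_heq (map_comp_obj _ _ _) rfl (P.castDom_heq _ _))
    · exact P.comp_heq List.map_map List.map_map rfl (P.castDom_heq _ _).symm
        (HomList.unary_heq F.obj ψ.app as).symm

/-- Whiskering of a 2-cell on the right. -/
def whiskerRight {F G : M ⟶ N} (φ : F ⟶ G) (H : N ⟶ P) : MultiTrans (F ≫ H) (G ≫ H) where
  app a := H.map (φ.app a)
  naturality {as b} f := by
    apply eq_of_heq
    have e := congrArg H.map (φ.naturality f)
    rw [H.map_comp, H.map_comp] at e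
    refine HEq.trans ?_ ((heq_of_eq e).trans ?_)
    · exact P.comp_heq (map_comp_obj _ _ _) rfl rfl HEq.rfl
        (HomList.cons_heq (map_comp_obj _ _ _) rfl rfl rfl (P.castDom_heq _ _) HEq.rfl)
    · refine P.comp_heq List.map_map List.map_map rfl (P.castDom_heq _ _).symm ?_
      clear e f
      induction as with
      | nil => exact HEq.rfl
      | cons a as ih => exact HomList.cons_heq rfl List.map_map rfl List.map_map HEq.rfl ih

theorem comp_single_one {a c : N.Obj} (g : N.Hom [a] c) : N.comp g (.single (N.one a)) = g :=
  N.comp_one g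

theorem naturality_of_eq {F G : M ⟶ N} (e : F = G) (app : ∀ a, N.Hom [F.obj a] (G.obj a))
    (h : ∀ a, app a ≍ N.one (F.obj a)) {as : List M.Obj} {b : M.Obj} (f : M.Hom as b) :
    N.comp (app b) (.single (F.map f)) = N.comp (G.map f) (.unary app as) := by
  subst e
  obtain rfl : app = fun a => N.one (F.obj a) := funext fun a => eq_of_heq (h a)
  exact MultiTrans.naturality (𝟙 F) f

/-- The invertible 2-cell between equal morphisms, with specified identity components. -/
@[simps]
def isoOfEq {F G : M ⟶ N} (e : F = G) (app : ∀ a, N.Hom [F.obj a] (G.obj a))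
    (app' : ∀ a, N.Hom [G.obj a] (F.obj a)) (h : ∀ a, app a ≍ N.one (F.obj a))
    (h' : ∀ a, app' a ≍ N.one (G.obj a)) : F ≅ G where
  hom := ⟨app, naturality_of_eq e app h⟩
  inv := ⟨app', naturality_of_eq e.symm app' h'⟩
  hom_inv_id := by
    subst e
    ext a
    exact (congrArg₂ (fun x y => N.comp x (.single y)) (eq_of_heq (h' a))
      (eq_of_heq (h a))).trans (N.one_comp _)
  inv_hom_id := by
    subst e
    ext a
    exact (congrArg₂ (fun x y => N.comp x (.single y)) (eq_of_heq (h a))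
      (eq_of_heq (h' a))).trans (N.one_comp _)

theorem eq_eqToIso {F G : M ⟶ N} (i : F ≅ G) (e : F = G)
    (h : ∀ a, i.hom.app a ≍ N.one (F.obj a)) : i = eqToIso e := by
  subst e
  ext a
  exact eq_of_heq (h a)

theorem id_comp' (F : M ⟶ N) : 𝟙 M ≫ F = F :=
  MultiFunctor.eq_of rfl fun _ _ f => (N.castDom_heq _ _).trans
    (F.map_heq (List.map_id' _) rfl (M.castDom_heq _ f))

theorem comp_id' (F : M ⟶ N) : F ≫ 𝟙 N = F :=
  MultiFunctor.eq_of rfl fun _ _ f => (N.castDom_heq _ _).trans (N.castDom_heq _ (F.map f))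

theorem assoc' {Q : Multicategory.{v, u}} (F : M ⟶ N) (G : N ⟶ P) (H : P ⟶ Q) :
    (F ≫ G) ≫ H = F ≫ G ≫ H :=
  MultiFunctor.eq_of rfl fun _ _ _ => (Q.castDom_heq _ _).trans
    ((H.map_heq (map_comp_obj F G _) rfl (P.castDom_heq _ _)).trans
      ((Q.castDom_heq _ _).trans (Q.castDom_heq _ _)).symm)

end Multicategory

open Multicategory in
instance : Bicategory Multicategory.{v, u} where
  whiskerLeft F _ _ ψ := whiskerLeft F ψ
  whiskerRight φ H := whiskerRight φ H
  associator {_ _ _ Q} F G H := isoOfEq (assoc' F G H)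
    (fun a => Q.one (H.obj (G.obj (F.obj a)))) (fun a => Q.one (H.obj (G.obj (F.obj a))))
    (fun _ => HEq.rfl) (fun _ => HEq.rfl)
  leftUnitor {_ N} F := isoOfEq (id_comp' F) (fun a => N.one (F.obj a))
    (fun a => N.one (F.obj a)) (fun _ => HEq.rfl) (fun _ => HEq.rfl)
  rightUnitor {_ N} F := isoOfEq (comp_id' F) (fun a => N.one (F.obj a))
    (fun a => N.one (F.obj a)) (fun _ => HEq.rfl) (fun _ => HEq.rfl)
  whiskerLeft_id F G := rfl
  whiskerLeft_comp F _ _ _ ψ χ := rfl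
  id_whiskerLeft {_ N _ _} η := by
    ext a
    exact ((comp_single_one _).trans (N.one_comp (η.app a))).symm
  comp_whiskerLeft {_ _ _ Q} F G _ _ η := by
    ext a
    exact ((comp_single_one _).trans (Q.one_comp (η.app (G.obj (F.obj a))))).symm
  id_whiskerRight F G := by
    ext a
    exact G.map_one (F.obj a)
  comp_whiskerRight φ ψ H := by
    ext a
    exact H.map_comp (ψ.app a) (.single (φ.app a))
  whiskerRight_id {_ N _ _} η := by
    ext a
    exact ((comp_single_one _).trans (N.one_comp (η.app a))).symm
  whiskerRight_comp {_ _ _ Q _ _} η G H := by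
    ext a
    exact ((comp_single_one _).trans (Q.one_comp (H.map (G.map (η.app a))))).symm
  whisker_assoc {_ _ _ Q} F _ _ η H := by
    ext a
    exact ((comp_single_one _).trans (Q.one_comp (H.map (η.app (F.obj a))))).symm
  whisker_exchange {_ _ P _ _ _ K} φ ψ := by
    ext a
    exact ψ.naturality (φ.app a) |>.symm
  pentagon {_ _ _ _ Q} F G H I := by
    ext a
    exact congrArg₂ (fun x y => Q.comp x (.single y))
      (Q.one_comp (Q.one (I.obj (H.obj (G.obj (F.obj a))))))
      (I.map_one (H.obj (G.obj (F.obj a))))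
  triangle {_ _ P} F G := by
    ext a
    exact (P.one_comp (P.one _)).trans (G.map_one (F.obj a)).symm

instance : Bicategory.Strict Multicategory.{v, u} where
  id_comp := Multicategory.id_comp'
  comp_id := Multicategory.comp_id'
  assoc := Multicategory.assoc'
  leftUnitor_eqToIso _ := Multicategory.eq_eqToIso _ _ fun _ => HEq.rfl
  rightUnitor_eqToIso _ := Multicategory.eq_eqToIso _ _ fun _ => HEq.rfl
  associator_eqToIso _ _ _ := Multicategory.eq_eqToIso _ _ fun _ => HEq.rfl

/-! ## Skew multicategories and left representability -/

/-- A skew multicategory. The underlying multicategory is that of the loose multimaps;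
`Tight a as b` is the set of tight multimaps `a, as → b` (so that there are no nullary tight
multimaps), and `loosen` is the comparison from tight to loose multimaps. A substitution
`g(f₁, …, fₙ)` is tight when `g` and `f₁` are so, and is otherwise loose. Since substitution
commutes with the comparisons, it is determined by the case where everything is loose, and the
case where `g` and `f₁` are tight and `f₂, …, fₙ` are loose. -/
structure SkewMulticategory extends Multicategory.{v, u} where
  Tight : Obj → List Obj → Obj → Type v
  loosen {a : Obj} {as : List Obj} {b : Obj} : Tight a as b → Hom (a :: as) b
  tightOne (a : Obj) : Tight a [] a
  /-- `tightComp h g f₁ (f₂, …, fₙ)` is `g(f₁, f₂, …, fₙ)`. -/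
  tightComp {a : Obj} {as as₁ as₂ : List Obj} {b : Obj} {bs : List Obj} {c : Obj}
    (h : as = as₁ ++ as₂) (g : Tight b bs c) (f : Tight a as₁ b) (fs : HomList Hom as₂ bs) :
    Tight a as c
  loosen_tightOne (a : Obj) : loosen (tightOne a) = one a
  loosen_tightComp {a : Obj} {as as₁ as₂ : List Obj} {b : Obj} {bs : List Obj} {c : Obj}
    (h : as = as₁ ++ as₂) (g : Tight b bs c) (f : Tight a as₁ b) (fs : HomList Hom as₂ bs) :
    loosen (tightComp h g f fs) =
      comp (loosen g) (.cons (congrArg (List.cons a) h) (loosen f) fs)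
  tightOne_comp {a : Obj} {as : List Obj} {c : Obj} (f : Tight a as c) :
    tightComp (List.append_nil as).symm (tightOne c) f .nil = f
  tightComp_one {b : Obj} {bs : List Obj} {c : Obj} (g : Tight b bs c) :
    tightComp (as₁ := []) rfl g (tightOne b) (.ones one bs) = g
  tight_assoc {a : Obj} {as as₁ as₂ : List Obj} {b : Obj} {bs bs₁ bs₂ : List Obj} {c : Obj}
    {cs : List Obj} {d : Obj} (h : Tight c cs d) (e : bs = bs₁ ++ bs₂) (g : Tight b bs₁ c)
    (gs : HomList Hom bs₂ cs) (e' : as = as₁ ++ as₂) (f : Tight a as₁ b)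
    (fs : HomList Hom as₂ bs) :
    tightComp e' (tightComp e h g gs) f fs =
      tightComp ((e'.trans (congrArg (as₁ ++ ·) (HomList.split bs₁ (e ▸ fs)).eq)).trans
          (List.append_assoc _ _ _).symm) h
        (tightComp rfl g f (HomList.split bs₁ (e ▸ fs)).fst)
        (gs.subst comp (HomList.split bs₁ (e ▸ fs)).snd)

namespace SkewMulticategory

variable (S : SkewMulticategory.{v, u})

/-- Substitution `g ∘₁ θ` of a tight `θ` in the first variable of a tight multimap `g`. -/
def precompTight {a : S.Obj} {as : List S.Obj} {m : S.Obj} (θ : S.Tight a as m)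
    (bs : List S.Obj) (c : S.Obj) (g : S.Tight m bs c) : S.Tight a (as ++ bs) c :=
  S.tightComp rfl g θ (.ones S.one bs)

/-- Substitution `g ∘₁ θ` of a loose `θ` in the first variable of a tight multimap `g`. -/
def precompLoose {as : List S.Obj} {m : S.Obj} (θ : S.Hom as m)
    (bs : List S.Obj) (c : S.Obj) (g : S.Tight m bs c) : S.Hom (as ++ bs) c :=
  S.comp (S.loosen g) (.cons rfl θ (.ones S.one bs))

/-- A universal tight multimap. -/
def IsTightUniversal {a : S.Obj} {as : List S.Obj} {m : S.Obj} (θ : S.Tight a as m) : Prop :=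
  ∀ b : S.Obj, Function.Bijective (S.precompTight θ [] b)

/-- A universal loose multimap. -/
def IsLooseUniversal {as : List S.Obj} {m : S.Obj} (θ : S.Hom as m) : Prop :=
  ∀ b : S.Obj, Function.Bijective (S.precompLoose θ [] b)

/-- Weak representability: there are universal multimaps out of every list, of either type. -/
def IsWeaklyRepresentable : Prop :=
  (∀ (a : S.Obj) (as : List S.Obj), ∃ (m : S.Obj) (θ : S.Tight a as m), S.IsTightUniversal θ) ∧
  (∀ as : List S.Obj, ∃ (m : S.Obj) (θ : S.Hom as m), S.IsLooseUniversal θ)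

/-- Left representability: weak representability, with every universal multimap left
universal. -/
def IsLeftRepresentable : Prop :=
  S.IsWeaklyRepresentable ∧
  (∀ (a : S.Obj) (as : List S.Obj) (m : S.Obj) (θ : S.Tight a as m), S.IsTightUniversal θ →
    ∀ (bs : List S.Obj) (c : S.Obj), Function.Bijective (S.precompTight θ bs c)) ∧
  (∀ (as : List S.Obj) (m : S.Obj) (θ : S.Hom as m), S.IsLooseUniversal θ →
    ∀ (bs : List S.Obj) (c : S.Obj), Function.Bijective (S.precompLoose θ bs c))

end SkewMulticategory

namespace Multicategory

/-- A multicategory, seen as a skew multicategory in which all multimaps are tight. -/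
def toSkew (M : Multicategory.{v, u}) : SkewMulticategory.{v, u} where
  toMulticategory := M
  Tight a as b := M.Hom (a :: as) b
  loosen f := f
  tightOne a := M.one a
  tightComp {a _ _ _ _ _ _} h g f fs := M.comp g (.cons (congrArg (List.cons a) h) f fs)
  loosen_tightOne a := rfl
  loosen_tightComp h g f fs := rfl
  tightOne_comp f := M.one_comp f
  tightComp_one g := M.comp_one g
  tight_assoc h e g gs e' f fs := by
    subst e e'
    exact M.assoc h _ _

/-- Left representability of a multicategory. -/
def IsLeftRepresentable (M : Multicategory.{v, u}) : Prop :=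
  M.toSkew.IsLeftRepresentable

end Multicategory

/-! ## The two 2-categories -/

open Bicategory

/-- A skew monoidal category is left normal if its left unit maps are invertible. -/
def SkewMonCat.IsLeftNormal (C : SkewMonCat.{v, u}) : Prop :=
  ∀ a : C.carrier, IsIso (SkewMonoidal.lam a)

/-- The 2-category of left normal skew monoidal categories, lax monoidal functors and monoidal
transformations. -/
abbrev LeftNormalSkewMonCat :=
  InducedBicategory SkewMonCat.{v, u} (fun C : {C : SkewMonCat.{v, u} // C.IsLeftNormal} => C.1)

/-- The 2-category of left representable multicategories, as a full sub-2-category of the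
2-category of multicategories. -/
abbrev LeftRepMulticategory :=
  InducedBicategory Multicategory.{v, u}
    (fun M : {M : Multicategory.{v, u} // M.IsLeftRepresentable} => M.1)

/-! ## 2-equivalences -/

/-- A 2-natural isomorphism between 2-functors: a family of strictly invertible 1-cells which is
strictly natural with respect to 1-cells and 2-cells. -/
structure TwoNatIso {B : Type u₁} [Bicategory.{w₁, v₁} B] {C : Type u₂} [Bicategory.{w₂, v₂} C]
    (F G : StrictPseudofunctor B C) where
  hom (a : B) : F.obj a ⟶ G.obj a
  inv (a : B) : G.obj a ⟶ F.obj a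
  hom_inv_id (a : B) : hom a ≫ inv a = 𝟙 (F.obj a)
  inv_hom_id (a : B) : inv a ≫ hom a = 𝟙 (G.obj a)
  naturality {a b : B} (f : a ⟶ b) : F.map f ≫ hom b = hom a ≫ G.map f
  naturality₂ {a b : B} {f g : a ⟶ b} (η : f ⟶ g) :
    F.map₂ η ▷ hom b ≫ eqToHom (naturality g) = eqToHom (naturality f) ≫ hom a ◁ G.map₂ η

/-- A 2-equivalence between 2-categories (strict bicategories): 2-functors in both directions
whose composites are 2-naturally isomorphic to the identities. -/
structure TwoEquivalence (B : Type u₁) [Bicategory.{w₁, v₁} B] [Bicategory.Strict B]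
    (C : Type u₂) [Bicategory.{w₂, v₂} C] [Bicategory.Strict C] where
  functor : StrictPseudofunctor B C
  inverse : StrictPseudofunctor C B
  unitIso : TwoNatIso (StrictPseudofunctor.id B) (functor.comp inverse)
  counitIso : TwoNatIso (inverse.comp functor) (StrictPseudofunctor.id C)

end SkewMult

/-! A multimap `as ⟶ b` of a skew monoidal category is a morphism `((i ⊗ a₁) ⊗ ⋯) ⊗ aₙ ⟶ b`. To
substitute, a list of multimaps `as ⟶ bs` is made to act from `X ⊗ a₁ ⊗ ⋯` to `X ⊗ b₁ ⊗ ⋯`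
(bracketed to the left) for every object `X`. For each block the map `rho` and iterated associators
give `X ⊗ a₁ ⊗ ⋯ ⟶ X ⊗ (i ⊗ a₁ ⊗ ⋯)`, after which `X ⊗ f` applies. Substitution is associative
because this action is natural in `X`, commutes with the iterated associators (`actList_actAssoc`)
and turns substitution into composition (`actList_subst`). The identities are the maps `lam`, and
none of this needs left normality.

If every `lam` is invertible, unary multimaps amount to morphisms. The identity of `i ⊗ a₁ ⊗ ⋯` is
then a universal multimap. By a Yoneda argument, a universal `θ` induces an invertible map `i ⊗ a₁ ⊗
⋯ ⟶ i ⊗ m`; tensoring with further objects keeps it invertible, so `θ` is left universal.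

The resulting 2-functor is bijective on 1-cells and 2-cells, and for this only the codomain has to
be left normal. A lax monoidal functor is recovered from its values on the multimaps `lam a ≫ f`, `𝟙
i` and `lam a ⊗ 𝟙 b`. For an arbitrary morphism of multicategories these values satisfy the lax
axioms, because suitable unary, binary and ternary multimaps can be evaluated in two ways
(`onMulti_cons`, `onMulti_append`).

Conversely, in a left representable multicategory choose universal multimaps out of `[]` and out of
each `[a, b]`. Left universality passes to their iterated substitutes, so the structure maps can be
defined, and the axioms checked, by precomposing with such multimaps. The inverse of `lam a` is the
universal bimap with the nullary universal multimap in its first place. Precomposition with the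
universal multimap `as ⟶ i ⊗ a₁ ⊗ ⋯` identifies the original multicategory with that of the new skew
monoidal category (`ofMultiHom_comp`, `ofMultiHom_bijective`).

It remains that a strict 2-functor bijective on 1-cells and 2-cells, and surjective on objects up to
strict isomorphism, belongs to a 2-equivalence: the inverse conjugates by the chosen isomorphisms
and takes preimages (`BijectiveTwoFunctor.twoEquivalence`). -/

namespace SkewMult

open CategoryTheory SkewMonoidal

/-! ### Iterated tensor products and the multicategory of a skew monoidal category -/

section Action

variable {C : Type u} [Category.{v} C] [SkewMonoidal C]

/-- The iterated tensor product `((X ⊗ a₁) ⊗ ⋯) ⊗ aₙ`. -/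
@[reducible]
def act : C → List C → C
  | X, [] => X
  | X, a :: as => act (tensor X a) as

theorem act_append (X : C) (as bs : List C) : act X (as ++ bs) = act (act X as) bs := by
  induction as generalizing X with
  | nil => rfl
  | cons a as ih => exact ih (tensor X a)

/-- Functoriality of `act` in its first argument. -/
def actMap : ∀ {X Y : C} (_ : X ⟶ Y) (as : List C), act X as ⟶ act Y as
  | _, _, f, [] => f
  | _, _, f, a :: as => actMap (tensorHom f (𝟙 a)) as

@[simp]
theorem actMap_nil {X Y : C} (f : X ⟶ Y) : actMap f [] = f := rfl

theorem actMap_cons {X Y : C} (f : X ⟶ Y) (a : C) (as : List C) :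
    actMap f (a :: as) = actMap (tensorHom f (𝟙 a)) as := rfl

@[simp]
theorem actMap_id (X : C) (as : List C) : actMap (𝟙 X) as = 𝟙 (act X as) := by
  induction as generalizing X with
  | nil => rfl
  | cons a as ih => rw [actMap_cons, tensorHom_id, ih]

theorem actMap_comp {X Y Z : C} (f : X ⟶ Y) (g : Y ⟶ Z) (as : List C) :
    actMap (f ≫ g) as = actMap f as ≫ actMap g as := by
  induction as generalizing X Y Z with
  | nil => rfl
  | cons a as ih => rw [actMap_cons, tensorHom_split, ih]; rfl

instance actMap_isIso {X Y : C} (f : X ⟶ Y) [IsIso f] (as : List C) : IsIso (actMap f as) :=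
  ⟨actMap (inv f) as, by simp [← actMap_comp], by simp [← actMap_comp]⟩

/-- The identification of `act X as` with `act (act X as₁) as₂` when `as = as₁ ++ as₂`. -/
def actSplit {as as₁ as₂ : List C} (h : as = as₁ ++ as₂) (X : C) :
    act X as ⟶ act (act X as₁) as₂ :=
  eqToHom (by rw [h, act_append])

theorem actSplit_nil (X : C) {as : List C} (h : as = [] ++ as) : actSplit h X = 𝟙 _ := rfl

theorem actSplit_cons (X a : C) {as as₁ as₂ : List C} (h : as = as₁ ++ as₂)
    (h' : a :: as = (a :: as₁) ++ as₂) :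
    actSplit h' X = actSplit h (tensor X a) := rfl

@[simp]
theorem actMap_eqToHom {X Y : C} (h : X = Y) (as : List C) :
    actMap (eqToHom h) as = eqToHom (congrArg (act · as) h) := by
  subst h
  exact actMap_id X as

/-- Everything here is an `eqToHom`, so the two composites agree by proof irrelevance. -/
theorem actSplit_assoc {as as₁ as₂ as₃ as₂₃ as₁₂ : List C} (h₁ : as = as₁ ++ as₂₃)
    (h₂ : as₂₃ = as₂ ++ as₃) (h₃ : as = as₁₂ ++ as₃) (h₄ : as₁₂ = as₁ ++ as₂) (X : C) :
    actSplit h₁ X ≫ actSplit h₂ (act X as₁) = actSplit h₃ X ≫ actMap (actSplit h₄ X) as₃ := by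
  simp [actSplit]

theorem actSplit_naturality {as as₁ as₂ : List C} (h : as = as₁ ++ as₂) {X Y : C} (f : X ⟶ Y) :
    actMap f as ≫ actSplit h Y = actSplit h X ≫ actMap (actMap f as₁) as₂ := by
  subst h
  induction as₁ generalizing X Y with
  | nil => exact (Category.comp_id _).trans (Category.id_comp _).symm
  | cons a as ih => exact ih (tensorHom f (𝟙 a))

/-- The iterated associator `((X ⊗ Y) ⊗ a₁) ⊗ ⋯ ⊗ aₙ ⟶ X ⊗ ((Y ⊗ a₁) ⊗ ⋯ ⊗ aₙ)`. -/
def actAssoc (X : C) : ∀ (Y : C) (as : List C), act (tensor X Y) as ⟶ tensor X (act Y as)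
  | _, [] => 𝟙 _
  | Y, a :: as => actMap (α X Y a) as ≫ actAssoc X (tensor Y a) as

theorem actAssoc_cons (X Y a : C) (as : List C) :
    actAssoc X Y (a :: as) = actMap (α X Y a) as ≫ actAssoc X (tensor Y a) as := rfl

/-- The map `(X ⊗ a₁) ⊗ ⋯ ⊗ aₙ ⟶ X ⊗ ((i ⊗ a₁) ⊗ ⋯ ⊗ aₙ)`. -/
def actUnit (X : C) (as : List C) : act X as ⟶ tensor X (act unit as) :=
  actMap (rho X) as ≫ actAssoc X unit as

theorem tensorHom_comp' {a a' a'' b b' b'' : C} (f : a ⟶ a') (f' : a' ⟶ a'') (g : b ⟶ b')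
    (g' : b' ⟶ b'') : tensorHom f g ≫ tensorHom f' g' = tensorHom (f ≫ f') (g ≫ g') :=
  (tensorHom_comp f f' g g').symm

instance tensorHom_isIso {a a' b b' : C} (f : a ⟶ a') (g : b ⟶ b') [IsIso f] [IsIso g] :
    IsIso (tensorHom f g) :=
  ⟨tensorHom (inv f) (inv g), by simp [tensorHom_comp', tensorHom_id],
    by simp [tensorHom_comp', tensorHom_id]⟩

theorem actAssoc_naturality {X X' Y Y' : C} (f : X ⟶ X') (g : Y ⟶ Y') (as : List C) :
    actMap (tensorHom f g) as ≫ actAssoc X' Y' as =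
      actAssoc X Y as ≫ tensorHom f (actMap g as) := by
  induction as generalizing Y Y' with
  | nil => exact (Category.comp_id _).trans (Category.id_comp _).symm
  | cons a as ih =>
    rw [actAssoc_cons, actAssoc_cons, actMap_cons, ← reassoc_of% actMap_comp, α_naturality,
      reassoc_of% actMap_comp, ih, Category.assoc, actMap_cons]

theorem actUnit_naturality {X X' : C} (f : X ⟶ X') (as : List C) :
    actMap f as ≫ actUnit X' as = actUnit X as ≫ tensorHom f (𝟙 _) := by
  rw [actUnit, actUnit, ← reassoc_of% actMap_comp, rho_naturality, reassoc_of% actMap_comp,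
    actAssoc_naturality, Category.assoc, actMap_id]

/-- Induction on `as₁`: the head associator is moved past the splitting by `actSplit_naturality`. -/
theorem actAssoc_append (X Y : C) {as as₁ as₂ : List C} (h : as = as₁ ++ as₂) :
    actSplit h (tensor X Y) ≫ actMap (actAssoc X Y as₁) as₂ ≫ actAssoc X (act Y as₁) as₂ =
      actAssoc X Y as ≫ tensorHom (𝟙 X) (actSplit h Y) := by
  subst h
  induction as₁ generalizing Y with
  | nil =>
    rw [actAssoc, actMap_id, actSplit_nil, actSplit_nil, tensorHom_id]
    exact (Category.id_comp _).trans ((Category.id_comp _).trans (Category.comp_id _).symm)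
  | cons a as ih =>
    rw [actSplit_cons (h := rfl), actSplit_cons (h := rfl), actAssoc_cons, reassoc_of% actMap_comp]
    have := actSplit_naturality (as := as ++ as₂) rfl (α X Y a)
    rw [← reassoc_of% this, ih]
    simp [actAssoc_cons]

/-- The pentagon, iterated along `as`. -/
theorem actAssoc_α (X Y Z : C) (as : List C) :
    actAssoc (tensor X Y) Z as ≫ α X Y (act Z as) =
      actMap (α X Y Z) as ≫ actAssoc X (tensor Y Z) as ≫ tensorHom (𝟙 X) (actAssoc Y Z as) := by
  induction as generalizing Z with
  | nil =>
    simp [actAssoc, act, tensorHom_id]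
  | cons a as ih =>
    rw [actAssoc_cons, Category.assoc]
    refine (congrArg (_ ≫ ·) (ih _)).trans ?_
    rw [← reassoc_of% actMap_comp, ← pentagon, reassoc_of% actMap_comp, reassoc_of% actMap_comp,
      reassoc_of% actAssoc_naturality, tensorHom_comp', Category.comp_id, actAssoc_cons,
        actAssoc_cons,
      Category.assoc]
    rfl

/-- The axiom `rho_α` handles the head, and `actAssoc_α` the rest of the list. -/
theorem actUnit_α (X Y : C) (as : List C) :
    actUnit (tensor X Y) as ≫ α X Y (act unit as) =
      actAssoc X Y as ≫ tensorHom (𝟙 X) (actUnit Y as) := by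
  rw [actUnit, Category.assoc, actAssoc_α, ← reassoc_of% actMap_comp, rho_α, reassoc_of%
    actAssoc_naturality,
    tensorHom_comp', Category.comp_id, actUnit]

theorem actAssoc_lam (Y : C) (as : List C) :
    actAssoc unit Y as ≫ lam (act Y as) = actMap (lam Y) as := by
  induction as generalizing Y with
  | nil => exact Category.id_comp _
  | cons a as ih =>
    rw [actAssoc_cons, Category.assoc]
    refine (congrArg (_ ≫ ·) (ih _)).trans ?_
    rw [← actMap_comp, α_lam, actMap_cons]

-- This comes from `rho_lam` and iterated `α_lam`. It makes `id(g) = g` hold in the multicategory,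
-- and it makes `actUnit unit as` the inverse of `lam` in the left normal case.
@[simp]
theorem actUnit_lam (as : List C) :
    actUnit (unit : C) as ≫ lam (act unit as) = 𝟙 _ := by
  rw [actUnit, Category.assoc, actAssoc_lam, ← actMap_comp, rho_lam, actMap_id]

/-- Multimaps `a₁, …, aₙ ⟶ b` in a skew monoidal category. -/
abbrev MultiHom (as : List C) (b : C) : Type v := act unit as ⟶ b

/-- The action of a list of multimaps. -/
def actList : ∀ (X : C) {as bs : List C}, HomList (MultiHom (C := C)) as bs → (act X as ⟶ act X bs)
  | _, _, _, .nil => 𝟙 _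
  | X, _, _, .cons (as₁ := as₁) (as₂ := as₂) (b := b) h f fs =>
    actSplit h X ≫ actMap (actUnit X as₁ ≫ tensorHom (𝟙 X) f) as₂ ≫ actList (tensor X b) fs

theorem actList_cons (X : C) {as as₁ as₂ : List C} {b : C} {bs : List C} (h : as = as₁ ++ as₂)
    (f : MultiHom as₁ b) (fs : HomList (MultiHom (C := C)) as₂ bs) :
    actList X (.cons h f fs) =
      actSplit h X ≫ actMap (actUnit X as₁ ≫ tensorHom (𝟙 X) f) as₂ ≫
        actList (tensor X b) fs := rfl

theorem actList_naturality {X Y : C} (f : X ⟶ Y) {as bs : List C}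
    (fs : HomList (MultiHom (C := C)) as bs) :
    actMap f as ≫ actList Y fs = actList X fs ≫ actMap f bs := by
  induction fs generalizing X Y with
  | nil => exact (Category.comp_id _).trans (Category.id_comp _).symm
  | cons h g gs ih =>
    rw [actList_cons, actList_cons, reassoc_of% actSplit_naturality, ← reassoc_of% actMap_comp,
      reassoc_of% actUnit_naturality, tensorHom_comp', Category.id_comp, Category.comp_id,
      Category.assoc, Category.assoc, actMap_cons, ← ih, ← reassoc_of% actMap_comp, Category.assoc,
      tensorHom_comp', Category.id_comp, Category.comp_id]

/-- The heart of associativity: acting on `X ⊗ Y` and then moving `X` outside is the same as acting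
on `Y` inside `X ⊗ -`. On each block this is `actUnit_α` together with naturality of `α`. -/
theorem actList_actAssoc (X Y : C) {as bs : List C} (fs : HomList (MultiHom (C := C)) as bs) :
    actList (tensor X Y) fs ≫ actAssoc X Y bs =
      actAssoc X Y as ≫ tensorHom (𝟙 X) (actList Y fs) := by
  induction fs generalizing Y with
  | nil =>
    rw [actList, actList, tensorHom_id]
    exact (Category.id_comp _).trans (Category.comp_id _).symm
  | @cons as as₁ as₂ b bs h g gs ih =>
    rw [actList_cons, actList_cons, actAssoc_cons, Category.assoc, Category.assoc,
      ← reassoc_of% actList_naturality, ih, ← reassoc_of% actMap_comp, Category.assoc]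
    have := α_naturality (𝟙 X) (𝟙 Y) g
    rw [tensorHom_id] at this
    rw [this, reassoc_of% actUnit_α, tensorHom_comp', Category.comp_id, reassoc_of% actMap_comp,
      reassoc_of% actAssoc_naturality, reassoc_of% actAssoc_append, tensorHom_comp',
        tensorHom_comp',
      Category.comp_id, Category.comp_id]

theorem actList_actUnit (X : C) {as bs : List C} (fs : HomList (MultiHom (C := C)) as bs) :
    actList X fs ≫ actUnit X bs = actUnit X as ≫ tensorHom (𝟙 X) (actList unit fs) := by
  rw [actUnit, ← reassoc_of% actList_naturality, actList_actAssoc, actUnit, Category.assoc]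

theorem actUnit_singleton (X a : C) : actUnit X [a] = tensorHom (rho X) (𝟙 a) ≫ α X unit a :=
  congrArg (tensorHom (rho X) (𝟙 a) ≫ ·) (Category.comp_id _)

-- The triangle axiom. It makes a list of identity multimaps act as the identity.
@[simp]
theorem actUnit_singleton_lam (X a : C) :
    actUnit X [a] ≫ tensorHom (𝟙 X) (lam a) = 𝟙 (tensor X a) := by
  rw [actUnit_singleton, Category.assoc, triangle]

theorem actList_ones (X : C) (as : List C) :
    actList X (.ones (Hom := MultiHom) lam as) = 𝟙 _ := by
  induction as generalizing X with
  | nil => rfl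
  | cons a as ih =>
    rw [HomList.ones, actList_cons, ih, actUnit_singleton_lam, actMap_id]
    exact (Category.id_comp _).trans (Category.id_comp _)

theorem actList_single (X : C) {as : List C} {b : C} (f : MultiHom as b) :
    actList X (.single (Hom := MultiHom) f) = actUnit X as ≫ tensorHom (𝟙 X) f :=
  (congrArg (actSplit (List.append_nil as).symm X ≫ ·) (Category.comp_id _)).trans
    (Category.id_comp _)

/-- A concatenated list acts by its first part on the initial segment and then by its second part.
This is what the recursion in `HomList.subst` requires. -/
theorem actList_split (X : C) {as : List C} (bs₁ : List C) {bs₂ : List C}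
    (fs : HomList (MultiHom (C := C)) as (bs₁ ++ bs₂)) :
    actList X fs ≫ actSplit rfl X =
      actSplit (fs.split bs₁).eq X ≫ actMap (actList X (fs.split bs₁).fst) (fs.split bs₁).right ≫
        actList (act X bs₁) (fs.split bs₁).snd := by
  induction bs₁ generalizing X as with
  | nil =>
    rw [actSplit_nil]
    refine (Category.comp_id _).trans ?_
    simp only [HomList.split, actList, actMap_id]
    exact ((Category.id_comp _).trans (Category.id_comp _)).symm
  | cons b bs₁ ih =>
    cases fs with
    | @cons _ as₁ as₂ _ _ h f fs =>
      subst h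
      rw [actSplit_cons (h := rfl), actList_cons, Category.assoc, Category.assoc]
      refine (congrArg (fun k => _ ≫ _ ≫ k) (ih (tensor X b) fs)).trans ?_
      simp only [actMap_comp, Category.assoc]
      rw [reassoc_of% actSplit_naturality, reassoc_of% actSplit_naturality, reassoc_of%
        actSplit_assoc _ _
        ((congrArg (as₁ ++ ·) (fs.split bs₁).eq).trans (List.append_assoc _ _ _).symm) rfl]
      refine congrArg (_ ≫ ·) ?_
      simp only [← reassoc_of% actMap_comp]
      rfl

/-- Cut `fs` at the first block of `gs`; `actList_actUnit` moves the action on that block inside `X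
⊗ -`, and naturality moves the head of `gs` past the remaining action. Taking `X = i` gives
associativity of substitution. -/
theorem actList_subst (X : C) {as bs cs : List C} (gs : HomList (MultiHom (C := C)) bs cs)
    (fs : HomList (MultiHom (C := C)) as bs) :
    actList X (gs.subst (fun {_ _ c} (g : MultiHom _ c) fs => actList unit fs ≫ g) fs) = actList X
      fs ≫ actList X gs := by
  induction gs generalizing X as with
  | nil =>  exact (Category.comp_id _).symm
  | @cons bs bs₁ bs₂ b cs h g gs ih =>
    subst h
    rw [HomList.subst, actList_cons, ih, actList_cons, reassoc_of% actList_split]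
    simp only [actMap_comp, Category.assoc, reassoc_of% actList_naturality, tensorHom_split']
    rw [← reassoc_of% actMap_comp (actList X _), actList_actUnit, reassoc_of% actMap_comp]

end Action

/-- The multicategory underlying a skew monoidal category, with multimaps
`((i ⊗ a₁) ⊗ ⋯) ⊗ aₙ ⟶ b`. -/
def toMulticategory (C : SkewMonCat.{v, u}) : Multicategory.{v, u} where
  Obj := C.carrier
  Hom as b := MultiHom as b
  one a := lam a
  comp g fs := actList unit fs ≫ g
  one_comp {as c} g := by
    rw [actList_single, Category.assoc, lam_naturality, reassoc_of% actUnit_lam]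
  comp_one g := by rw [actList_ones]; exact Category.id_comp g
  assoc h gs fs := by rw [actList_subst, Category.assoc]

end SkewMult

/-! ### From lax monoidal functors and monoidal transformations to multicategory morphisms and
2-cells -/

namespace SkewMult

open CategoryTheory SkewMonoidal

theorem actSplit_map {C : Type u} [Category.{v} C] [SkewMonoidal C] {I : Type u₁} (F : I → C)
    {as as₁ as₂ : List I} (h : as = as₁ ++ as₂) : as.map F = as₁.map F ++ as₂.map F := by
  rw [h, List.map_append]

theorem actMap_map_cons {C : Type u} [Category.{v} C] [SkewMonoidal C] {X Y : C} (f : X ⟶ Y)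
    {I : Type u₁} (F : I → C) (a : I) (as : List I) :
    actMap f ((a :: as).map F) = actMap (tensorHom f (𝟙 (F a))) (as.map F) := rfl

theorem actAssoc_map_cons {C : Type u} [Category.{v} C] [SkewMonoidal C] (X Y : C)
    {I : Type u₁} (F : I → C) (a : I) (as : List I) :
    actAssoc X Y ((a :: as).map F) =
      actMap (α X Y (F a)) (as.map F) ≫ actAssoc X (tensor Y (F a)) (as.map F) := rfl

/-- Heterogeneous equality enters because mapping a list along an identity or a composite agrees
only propositionally with leaving it alone or mapping it twice. -/
theorem actMap_comp_heq {C : Type u} [Category.{v} C] [SkewMonoidal C] {X Y Z : C} (f : X ⟶ Y)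
    {as bs : List C} (h : as = bs) {k : act Y as ⟶ Z} {k' : act Y bs ⟶ Z} (hk : k ≍ k') :
    actMap f as ≫ k ≍ actMap f bs ≫ k' := by
  subst h
  rw [eq_of_heq hk]

theorem comp_heq_comp {C : Type u} [Category.{v} C] {X X' Y Z : C} (h : X = X') {f : X ⟶ Y}
    {f' : X' ⟶ Y} (hf : f ≍ f') (g : Y ⟶ Z) : f ≫ g ≍ f' ≫ g := by
  subst h
  rw [eq_of_heq hf]

namespace LaxMonFunctor

variable {C D E : SkewMonCat.{v, u}} (F : LaxMonFunctor C D)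

/-- The iterated structure map
`((F X ⊗ F a₁) ⊗ ⋯) ⊗ F aₙ ⟶ F (((X ⊗ a₁) ⊗ ⋯) ⊗ aₙ)` of a lax monoidal functor. -/
def μAct : ∀ (X : C.carrier) (as : List C.carrier),
    act (F.functor.obj X) (as.map F.functor.obj) ⟶ F.functor.obj (act X as)
  | _, [] => 𝟙 _
  | X, a :: as => actMap (F.μ X a) (as.map F.functor.obj) ≫ μAct (tensor X a) as

theorem μAct_cons (X a : C.carrier) (as : List C.carrier) :
    F.μAct X (a :: as) = actMap (F.μ X a) (as.map F.functor.obj) ≫ F.μAct (tensor X a) as := rfl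

theorem μAct_naturality {X Y : C.carrier} (f : X ⟶ Y) (as : List C.carrier) :
    actMap (F.functor.map f) (as.map F.functor.obj) ≫ F.μAct Y as =
      F.μAct X as ≫ F.functor.map (actMap f as) := by
  induction as generalizing X Y with
  | nil => exact (Category.comp_id _).trans (Category.id_comp _).symm
  | cons a as ih =>
    have h := F.μ_naturality f (𝟙 a)
    rw [F.functor.map_id] at h
    rw [μAct_cons, μAct_cons]
    rw [actMap_map_cons, ← reassoc_of% actMap_comp, h, reassoc_of% actMap_comp, ih, Category.assoc,
      actMap_cons]

theorem μAct_append (X : C.carrier) {as as₁ as₂ : List C.carrier} (h : as = as₁ ++ as₂) :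
    F.μAct X as ≫ F.functor.map (actSplit h X) =
      actSplit (actSplit_map F.functor.obj h) (F.functor.obj X) ≫
        actMap (F.μAct X as₁) (as₂.map F.functor.obj) ≫ F.μAct (act X as₁) as₂ := by
  subst h
  induction as₁ generalizing X with
  | nil =>
    rw [actSplit_nil, F.functor.map_id, μAct, actMap_id]
    exact (Category.comp_id (F.μAct X as₂)).trans ((Category.id_comp _).trans (Category.id_comp
      _)).symm
  | cons a as ih =>
    rw [actSplit_cons (h := rfl), μAct_cons]
    have h' : (as ++ as₂).map F.functor.obj = as.map F.functor.obj ++ as₂.map F.functor.obj :=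
      List.map_append
    rw [actSplit_cons (h := h'), show F.μAct X (a :: as ++ as₂) = _ from
      F.μAct_cons X a (as ++ as₂), Category.assoc, ih, actMap_comp]
    simp only [Category.assoc]
    rw [reassoc_of% actSplit_naturality]

/-- Lax associativity, iterated along `as`. -/
theorem μAct_actAssoc (X Y : C.carrier) (as : List C.carrier) :
    actMap (F.μ X Y) (as.map F.functor.obj) ≫ F.μAct (tensor X Y) as ≫
        F.functor.map (actAssoc X Y as) =
      actAssoc (F.functor.obj X) (F.functor.obj Y) (as.map F.functor.obj) ≫
        tensorHom (𝟙 _) (F.μAct Y as) ≫ F.μ X (act Y as) := by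
  induction as generalizing Y with
  | nil =>
    have h : 𝟙 (tensor (F.functor.obj X) (F.functor.obj Y)) ≫
        tensorHom (𝟙 (F.functor.obj X)) (𝟙 (F.functor.obj Y)) ≫ F.μ X Y =
          F.μ X Y ≫ 𝟙 _ ≫ F.functor.map (𝟙 (tensor X Y)) := by
      simp [tensorHom_id]
    exact h.symm
  | cons a as ih =>
    rw [μAct_cons, actAssoc_cons, F.functor.map_comp, Category.assoc,
      ← reassoc_of% F.μAct_naturality]
    rw [actMap_map_cons, actAssoc_map_cons, ← reassoc_of% actMap_comp, ← reassoc_of% actMap_comp,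
      Category.assoc, F.associativity, reassoc_of% actMap_comp, reassoc_of% actMap_comp, ih,
      reassoc_of% actAssoc_naturality, reassoc_of% tensorHom_comp', Category.comp_id,
      μAct_cons, Category.assoc]

/-- The iterated structure map
`((i ⊗ F a₁) ⊗ ⋯) ⊗ F aₙ ⟶ F (((i ⊗ a₁) ⊗ ⋯) ⊗ aₙ)` of a lax monoidal functor. -/
def εAct (as : List C.carrier) :
    act (unit : D.carrier) (as.map F.functor.obj) ⟶ F.functor.obj (act unit as) :=
  actMap F.ε (as.map F.functor.obj) ≫ F.μAct unit as

/-- Right unitality, followed by iterated associativity through `μAct_actAssoc`. -/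
theorem μAct_actUnit (X : C.carrier) (as : List C.carrier) :
    F.μAct X as ≫ F.functor.map (actUnit X as) =
      actUnit (F.functor.obj X) (as.map F.functor.obj) ≫
        tensorHom (𝟙 _) (F.εAct as) ≫ F.μ X (act unit as) := by
  rw [actUnit, F.functor.map_comp, ← reassoc_of% F.μAct_naturality, ← F.right_unitality,
    actMap_comp, actMap_comp]
  simp only [Category.assoc]
  rw [F.μAct_actAssoc, reassoc_of% actAssoc_naturality, reassoc_of% tensorHom_comp',
    Category.comp_id, actUnit, Category.assoc, εAct]

/-- The action of a lax monoidal functor on multimaps. -/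
def mapMulti {as : List C.carrier} {b : C.carrier} (f : MultiHom as b) :
    MultiHom (as.map F.functor.obj) (F.functor.obj b) :=
  F.εAct as ≫ F.functor.map f

theorem mapMulti_eq {as : List C.carrier} {b : C.carrier} (f : MultiHom as b) :
    F.mapMulti f = F.εAct as ≫ F.functor.map f := rfl

/-- The iterated structure maps intertwine the actions in the two categories; at `X = i` this yields
preservation of substitution. -/
theorem actList_map (X : C.carrier) {as bs : List C.carrier}
    (fs : HomList (MultiHom (C := C.carrier)) as bs) :
    actList (F.functor.obj X) (fs.map (Hom' := MultiHom) F.functor.obj F.mapMulti) ≫ F.μAct X bs =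
      F.μAct X as ≫ F.functor.map (actList X fs) := by
  induction fs generalizing X with
  | nil =>
    have h : 𝟙 (F.functor.obj X) ≫ 𝟙 (F.functor.obj X) = 𝟙 _ ≫ F.functor.map (𝟙 X) := by simp
    exact h
  | @cons as as₁ as₂ b bs h f fs ih =>
    have hf := F.μ_naturality (𝟙 X) f
    rw [F.functor.map_id] at hf
    rw [HomList.map, μAct_cons, actList_cons, actList_cons, F.functor.map_comp,
      F.functor.map_comp, reassoc_of% F.μAct_append, ← reassoc_of% F.μAct_naturality, ← ih,
      F.functor.map_comp]
    rw [Category.assoc, Category.assoc, ← reassoc_of% actList_naturality]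
    simp only [← reassoc_of% actMap_comp, Category.assoc]
    rw [reassoc_of% F.μAct_actUnit, ← hf, mapMulti, tensorHom_split']
    simp only [Category.assoc]

theorem mapMulti_comp {as bs : List C.carrier} {c : C.carrier} (g : MultiHom bs c)
    (fs : HomList (MultiHom (C := C.carrier)) as bs) :
    F.mapMulti (actList unit fs ≫ g) =
      actList unit (fs.map (Hom' := MultiHom) F.functor.obj F.mapMulti) ≫ F.mapMulti g := by
  rw [mapMulti, F.functor.map_comp, εAct, Category.assoc, ← reassoc_of% F.actList_map,
    reassoc_of% actList_naturality, mapMulti, εAct, Category.assoc]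

/-- The morphism of multicategories induced by a lax monoidal functor. -/
def toMultiFunctor : MultiFunctor (toMulticategory C) (toMulticategory D) where
  obj := F.functor.obj
  map f := F.mapMulti f
  map_one a := by
    -- As `lam` is the identity multimap, left unitality says precisely that identities are
    -- preserved.
    refine Eq.trans ?_ (F.left_unitality a)
    simp [mapMulti, εAct, μAct, toMulticategory]
    rfl
  map_comp g fs := by
    exact F.mapMulti_comp g fs

theorem μAct_id (X : C.carrier) (as : List C.carrier) :
    (LaxMonFunctor.id C).μAct X as ≍ 𝟙 (act X as) := by
  induction as generalizing X with
  | nil => rfl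
  | cons a as ih =>
    refine (actMap_comp_heq (𝟙 (tensor X a)) (List.map_id' as) (ih (tensor X a))).trans ?_
    exact heq_of_eq ((Category.comp_id _).trans (actMap_id _ _))

theorem εAct_id (as : List C.carrier) : (LaxMonFunctor.id C).εAct as ≍ 𝟙 (act unit as) :=
  (actMap_comp_heq (𝟙 (unit : C.carrier)) (List.map_id' as) (μAct_id unit as)).trans
    (heq_of_eq ((Category.comp_id _).trans (actMap_id _ _)))

theorem μAct_comp (G : LaxMonFunctor D E) (X : C.carrier) (as : List C.carrier) :
    (F.comp G).μAct X as ≍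
      G.μAct (F.functor.obj X) (as.map F.functor.obj) ≫ G.functor.map (F.μAct X as) := by
  induction as generalizing X with
  | nil =>
    have h : 𝟙 (G.functor.obj (F.functor.obj X)) = 𝟙 _ ≫ G.functor.map (𝟙 (F.functor.obj X)) := by
      simp
    exact heq_of_eq h
  | cons a as ih =>
    refine (actMap_comp_heq (G.μ (F.functor.obj X) (F.functor.obj a) ≫ G.functor.map (F.μ X a))
      (List.map_map (g := G.functor.obj) (f := F.functor.obj)).symm (ih (tensor X a))).trans
      (heq_of_eq ?_)
    have h := G.μAct_naturality (F.μ X a) (as.map F.functor.obj)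
    have h' : actMap (G.μ (F.functor.obj X) (F.functor.obj a) ≫ G.functor.map (F.μ X a)) _ ≫
        G.μAct (F.functor.obj (tensor X a)) (as.map F.functor.obj) ≫
          G.functor.map (F.μAct (tensor X a) as) =
        (actMap (G.μ (F.functor.obj X) (F.functor.obj a)) _ ≫
          G.μAct (tensor (F.functor.obj X) (F.functor.obj a)) (as.map F.functor.obj)) ≫
            G.functor.map (actMap (F.μ X a) _ ≫ F.μAct (tensor X a) as) := by
      rw [actMap_comp, Category.assoc, reassoc_of% h, ← G.functor.map_comp, Category.assoc]
    exact h'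

theorem εAct_comp (G : LaxMonFunctor D E) (as : List C.carrier) :
    (F.comp G).εAct as ≍ G.εAct (as.map F.functor.obj) ≫ G.functor.map (F.εAct as) := by
  refine (actMap_comp_heq (G.ε ≫ G.functor.map F.ε)
    (List.map_map (g := G.functor.obj) (f := F.functor.obj)).symm
    (F.μAct_comp G unit as)).trans (heq_of_eq ?_)
  have h := G.μAct_naturality F.ε (as.map F.functor.obj)
  have h' : actMap (G.ε ≫ G.functor.map F.ε) _ ≫
      G.μAct (F.functor.obj unit) (as.map F.functor.obj) ≫ G.functor.map (F.μAct unit as) =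
      (actMap G.ε _ ≫ G.μAct unit (as.map F.functor.obj)) ≫
        G.functor.map (actMap F.ε _ ≫ F.μAct unit as) := by
    rw [actMap_comp, Category.assoc, reassoc_of% h, ← G.functor.map_comp, Category.assoc]
  exact h'

theorem toMultiFunctor_id (C : SkewMonCat.{v, u}) :
    (LaxMonFunctor.id C).toMultiFunctor = MultiFunctor.id (toMulticategory C) := by
  refine MultiFunctor.eq_of rfl fun as b f => ?_
  refine HEq.trans ?_ ((toMulticategory C).castDom_heq _ f).symm
  exact (comp_heq_comp (C := C.carrier) (congrArg (act (C := C.carrier) unit) (List.map_id' as))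
    (εAct_id as) f).trans
    (heq_of_eq (Category.id_comp f))

theorem toMultiFunctor_comp (G : LaxMonFunctor D E) :
    (F.comp G).toMultiFunctor = MultiFunctor.comp F.toMultiFunctor G.toMultiFunctor := by
  refine MultiFunctor.eq_of rfl fun as b f => ?_
  refine HEq.trans ?_ ((toMulticategory E).castDom_heq _ _).symm
  refine (comp_heq_comp (C := E.carrier) (congrArg (act (C := E.carrier) unit) (List.map_map (g :=
    G.functor.obj) (f := F.functor.obj) (l := as)).symm) (F.εAct_comp G as)
    (G.functor.map (F.functor.map f))).trans (heq_of_eq ?_)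
  exact (Category.assoc _ _ _).trans
    (congrArg (G.εAct (as.map F.functor.obj) ≫ ·) (G.functor.map_comp (F.εAct as) (F.functor.map
      f)).symm)

end LaxMonFunctor

namespace MonNatTrans

variable {C D : SkewMonCat.{v, u}} {F G : LaxMonFunctor C D} (t : MonNatTrans F G)

/-- The components of the 2-cell of multicategories induced by a monoidal transformation. -/
def multiApp (a : C.carrier) : MultiHom [F.functor.obj a] (G.functor.obj a) :=
  lam (F.functor.obj a) ≫ t.trans.app a

theorem multiApp_eq (a : C.carrier) :
    t.multiApp a = lam (F.functor.obj a) ≫ t.trans.app a := rfl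

/-- The tensor axiom of a monoidal transformation, iterated along `as`; the factors `lam` in the
components are absorbed by the triangle axiom. -/
theorem actList_unary (X : C.carrier) (as : List C.carrier) :
    actMap (t.trans.app X) (as.map F.functor.obj) ≫ actList (G.functor.obj X) (.unary (Hom :=
      MultiHom) t.multiApp as) ≫ G.μAct X as =
      F.μAct X as ≫ t.trans.app (act X as) := by
  induction as generalizing X with
  | nil =>
    have h : t.trans.app X ≫ 𝟙 _ ≫ 𝟙 _ = 𝟙 _ ≫ t.trans.app X := by simp
    exact h
  | cons a as ih =>
    have h := t.tensor_app X a
    rw [LaxMonFunctor.μAct_cons F, Category.assoc, ← ih, ← reassoc_of% actMap_comp, h,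
      HomList.unary, actList_cons, LaxMonFunctor.μAct_cons]
    rw [multiApp_eq, tensorHom_split', reassoc_of% actUnit_singleton_lam, actMap_map_cons]
    change _ ≫ (𝟙 (act (tensor (G.functor.obj X) (F.functor.obj a)) (as.map F.functor.obj)) ≫ _) ≫
      _ = _
    rw [Category.id_comp, Category.assoc, actMap_comp, Category.assoc, ← reassoc_of% actMap_comp,
      tensorHom_comp', Category.comp_id, Category.id_comp, ← reassoc_of% actList_naturality (G.μ X
        a)]

theorem multiApp_naturality {as : List C.carrier} {b : C.carrier} (f : MultiHom as b) :
    actList unit (.single (Hom := MultiHom) (F.mapMulti f)) ≫ t.multiApp b =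
      actList unit (.unary (Hom := MultiHom) t.multiApp as) ≫ G.mapMulti f := by
  rw [actList_single, multiApp_eq t b, Category.assoc, reassoc_of% lam_naturality,
    reassoc_of% actUnit_lam, F.mapMulti_eq f, G.mapMulti_eq f, Category.assoc,
    t.trans.naturality, LaxMonFunctor.εAct, LaxMonFunctor.εAct, Category.assoc, Category.assoc,
    ← reassoc_of% t.actList_unary, ← reassoc_of% actMap_comp, t.unit_app,
    reassoc_of% actList_naturality]

/-- The 2-cell of multicategories induced by a monoidal transformation. -/
def toMultiTrans : MultiTrans F.toMultiFunctor G.toMultiFunctor where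
  app a := t.multiApp a
  naturality f := t.multiApp_naturality f

end MonNatTrans

end SkewMult

/-! ### Left normality implies left representability -/

namespace SkewMult

open CategoryTheory SkewMonoidal

namespace Multicategory

/-- Substitution `g(θ, 1, …, 1)` in the first variable. -/
def precomp (M : Multicategory.{v, u}) {as : List M.Obj} {m : M.Obj} (θ : M.Hom as m)
    (bs : List M.Obj) (c : M.Obj) (g : M.Hom (m :: bs) c) : M.Hom (as ++ bs) c :=
  M.comp g (.cons rfl θ (.ones M.one bs))

/-- When all multimaps are tight, the tight conditions are the loose ones for non-empty lists, so
they can be dropped. -/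
theorem isLeftRepresentable_iff (M : Multicategory.{v, u}) :
    M.IsLeftRepresentable ↔
      (∀ as : List M.Obj, ∃ (m : M.Obj) (θ : M.Hom as m), ∀ b, Function.Bijective (M.precomp θ []
        b)) ∧
      (∀ (as : List M.Obj) (m : M.Obj) (θ : M.Hom as m), (∀ b, Function.Bijective (M.precomp θ []
        b)) →
        ∀ (bs : List M.Obj) (c : M.Obj), Function.Bijective (M.precomp θ bs c)) :=
  ⟨fun h => ⟨h.1.2, h.2.2⟩, fun h => ⟨⟨fun a as => h.1 (a :: as), h.1⟩,
    fun a as => h.2 (a :: as), h.2⟩⟩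

end Multicategory

/-- Yoneda: surjectivity at `X` produces a retraction of `k`, and injectivity at `Y` makes it a
two-sided inverse. The isomorphism `e` allows for the list splitting. -/
theorem isIso_of_bijective {C : Type u} [Category.{v} C] {X' X Y : C} {e : X' ⟶ X} (_ : IsIso e)
    (k : X ⟶ Y)
    (h : ∀ c, Function.Bijective fun g : Y ⟶ c => e ≫ k ≫ g) : IsIso k := by
  obtain ⟨g, hg⟩ := (h X).2 e
  have hg' : k ≫ g = 𝟙 X := by
    rw [← cancel_epi e, Category.comp_id]
    exact hg
  refine ⟨g, hg', (h Y).1 ?_⟩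
  simp [reassoc_of% hg']

theorem bijective_of_isIso {C : Type u} [Category.{v} C] {X' X Y : C} (e : X' ⟶ X) [IsIso e] (k :
    X ⟶ Y) [IsIso k] (c : C) :
    Function.Bijective fun g : Y ⟶ c => e ≫ k ≫ g :=
  ⟨fun g g' h => (cancel_epi k).1 ((cancel_epi e).1 h), fun f => ⟨inv k ≫ inv e ≫ f, by simp⟩⟩

section LeftNormal

variable {C : Type u} [Category.{v} C] [SkewMonoidal C]

theorem actUnit_eq_inv (as : List C) [IsIso (lam (act (unit : C) as))] :
    actUnit (unit : C) as = inv (lam (act unit as)) :=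
  by rw [← cancel_mono (lam (act unit as)), actUnit_lam, IsIso.inv_hom_id]

instance actSplit_isIso {as as₁ as₂ : List C} (h : as = as₁ ++ as₂) (X : C) :
    IsIso (actSplit h X) := by
  unfold actSplit
  infer_instance

theorem actList_cons_ones {as : List C} {m : C} (θ : MultiHom as m) (bs : List C) {c : C}
    (g : MultiHom (m :: bs) c) :
    actList unit (.cons (Hom := MultiHom) rfl θ (.ones (Hom := MultiHom) lam bs)) ≫ g =
      actSplit rfl unit ≫ actMap (actUnit unit as ≫ tensorHom (𝟙 unit) θ) bs ≫ g := by
  rw [actList_cons, actList_ones, Category.assoc, Category.assoc, Category.id_comp]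

end LeftNormal

theorem bijective_precomp_iff {C : SkewMonCat.{v, u}} {as : List C.carrier} {m : C.carrier}
    (θ : MultiHom as m) (bs : List C.carrier) (c : C.carrier) :
    Function.Bijective ((toMulticategory C).precomp θ bs c) ↔
      Function.Bijective fun g : act (tensor unit m) bs ⟶ c =>
        actSplit (as := as ++ bs) rfl unit ≫
          actMap (actUnit unit as ≫ tensorHom (𝟙 unit) θ) bs ≫ g :=
  iff_of_eq (congrArg Function.Bijective (funext fun g => actList_cons_ones θ bs g))

theorem toMulticategory_isLeftRepresentable {C : SkewMonCat.{v, u}} (hC : C.IsLeftNormal) :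
    (toMulticategory C).IsLeftRepresentable := by
  rw [Multicategory.isLeftRepresentable_iff]
  constructor
  · intro (as : List C.carrier)
    have := hC (act unit as)
    have : IsIso (actUnit (unit : C.carrier) as) := by
      rw [actUnit_eq_inv]
      infer_instance
    -- The universal multimap is the identity of `i ⊗ a₁ ⊗ ⋯`; precomposing with it amounts to
    -- composing with `actUnit unit as`, the inverse of `lam`.
    exact ⟨(act unit as : C.carrier), 𝟙 (act unit as : C.carrier), fun b =>
      (bijective_precomp_iff (𝟙 (act unit as : C.carrier)) [] b).2 (bijective_of_isIso _ _ _)⟩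
  · intro (as : List C.carrier) (m : C.carrier) (θ : MultiHom as m) h (bs : List C.carrier)
      (c : C.carrier)
    -- Universality concerns only `bs = []`, but it makes this map invertible, and `actMap` keeps it
    -- invertible for every `bs`.
    have : IsIso (actUnit unit as ≫ tensorHom (𝟙 unit) θ) :=
      isIso_of_bijective (actSplit_isIso (as := as ++ []) (as₂ := []) rfl unit) _
        fun c => (bijective_precomp_iff θ [] c).1 (h c)
    exact (bijective_precomp_iff θ bs c).2 (bijective_of_isIso _ _ _)

end SkewMult

/-! ### Bijectivity on 2-cells -/

namespace SkewMult

open CategoryTheory SkewMonoidal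

section Pairs

variable {C : Type u} [Category.{v} C] [SkewMonoidal C]

theorem actUnit_singleton_lam_comp (X : C) {a b : C} (f : a ⟶ b) :
    actUnit X [a] ≫ tensorHom (𝟙 X) (lam a ≫ f) = tensorHom (𝟙 X) f := by
  rw [tensorHom_split', reassoc_of% actUnit_singleton_lam]

/-- Recovers the associator from the canonical map `actUnit`; this is how lax associativity is later
extracted from the substitution law. -/
theorem actUnit_pair (X a b : C) :
    actUnit X [a, b] ≫ tensorHom (𝟙 X) (tensorHom (lam a) (𝟙 b)) = α X a b := by
  have h : actUnit X [a, b] =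
      tensorHom (actUnit X [a]) (𝟙 b) ≫ α X (tensor unit a) b := by
    rw [actUnit_singleton, tensorHom_split, Category.assoc]
    exact congrArg (fun k => tensorHom (tensorHom (rho X) (𝟙 a)) (𝟙 b) ≫
      tensorHom (α X unit a) (𝟙 b) ≫ k) (Category.comp_id (α X (tensor unit a) b))
  rw [h, Category.assoc, ← α_naturality, reassoc_of% tensorHom_comp', actUnit_singleton_lam,
    Category.comp_id, tensorHom_id, Category.id_comp]

theorem actList_cons_single (X : C) {a a' b : C} {as : List C} (f : MultiHom [a] a')
    (g : MultiHom as b) :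
    actList X (.cons (Hom := MultiHom) (as := a :: as) (as₁ := [a]) rfl f (.single g)) =
      actMap (actUnit X [a] ≫ tensorHom (𝟙 X) f) as ≫
        actUnit (tensor X a') as ≫ tensorHom (𝟙 (tensor X a')) g := by
  rw [actList_cons, actList_single]
  exact Category.id_comp _

/-- Here `tensorHom (lam a') (𝟙 b)` plays the role of the universal bimap, into which a unary
multimap and `g` are substituted. -/
theorem actList_cons_single_lam {a a' b : C} {as : List C} (f : a ⟶ a') (g : MultiHom as b) :
    actList unit (.cons (Hom := MultiHom) (as := a :: as) (as₁ := [a]) rfl (lam a ≫ f)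
        (.single g)) ≫ tensorHom (lam a') (𝟙 b) =
      actMap (lam a ≫ f) as ≫ actUnit a' as ≫ tensorHom (𝟙 a') g := by
  rw [actList_cons_single, actUnit_singleton_lam_comp, Category.assoc, Category.assoc,
    tensorHom_comp', Category.id_comp, Category.comp_id, ← lam_naturality, actMap_comp,
    Category.assoc, reassoc_of% actUnit_naturality (lam a'), tensorHom_comp', Category.comp_id,
    Category.id_comp]

theorem actList_append_lam (X : C) {as as₁ : List C} {a b : C} (h : as = as₁ ++ [b])
    (f : MultiHom as₁ a) :
    actList X (.cons (Hom := MultiHom) h f (.single (Hom := MultiHom) (as := [b]) (lam b))) =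
      actSplit h X ≫ tensorHom (actUnit X as₁ ≫ tensorHom (𝟙 X) f) (𝟙 b) := by
  rw [actList_cons, actList_single, actUnit_singleton_lam]
  exact congrArg (actSplit h X ≫ ·) (Category.comp_id _)

end Pairs

variable {C D : SkewMonCat.{v, u}}

namespace LaxMonFunctor

variable (F : LaxMonFunctor C D)

theorem εAct_append (as : List C.carrier) (b : C.carrier) :
    F.εAct (as ++ [b]) ≫ F.functor.map (actSplit (as := as ++ [b]) (as₂ := [b]) rfl unit) =
      actSplit (as₂ := [F.functor.obj b]) List.map_append unit ≫
        tensorHom (F.εAct as) (𝟙 _) ≫ F.μ (act unit as) b := by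
  have h : F.μAct (act unit as) [b] = F.μ (act unit as) b := Category.comp_id _
  rw [εAct, Category.assoc, F.μAct_append, reassoc_of% actSplit_naturality]
  have h₂ : actMap (F.εAct as) [F.functor.obj b] = tensorHom (F.εAct as) (𝟙 _) := rfl
  rw [← h₂, εAct, actMap_comp, Category.assoc, h]
  rfl

theorem εAct_singleton (a : C.carrier) :
    F.εAct [a] = tensorHom F.ε (𝟙 (F.functor.obj a)) ≫ F.μ unit a :=
  congrArg (tensorHom F.ε (𝟙 (F.functor.obj a)) ≫ ·) (Category.comp_id (F.μ unit a))

theorem εAct_pair (a b : C.carrier) :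
    F.εAct [a, b] =
      tensorHom (F.εAct [a]) (𝟙 (F.functor.obj b)) ≫ F.μ (tensor unit a) b := by
  rw [εAct_singleton, tensorHom_split, Category.assoc]
  exact congrArg (fun k => tensorHom (tensorHom F.ε (𝟙 (F.functor.obj a))) (𝟙 (F.functor.obj b)) ≫
    tensorHom (F.μ unit a) (𝟙 (F.functor.obj b)) ≫ k) (Category.comp_id _)

theorem mapMulti_lam {a b : C.carrier} (f : a ⟶ b) :
    F.mapMulti (as := [a]) (lam a ≫ f) = lam (F.functor.obj a) ≫ F.functor.map f := by
  rw [← F.left_unitality, mapMulti, F.functor.map_comp, εAct_singleton]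
  simp only [Category.assoc]

theorem mapMulti_id_unit : F.mapMulti (as := []) (𝟙 (unit : C.carrier)) = F.ε := by
  rw [mapMulti, F.functor.map_id, Category.comp_id]
  exact Category.comp_id F.ε

/-- With `mapMulti_lam` and `mapMulti_id_unit`, this shows that all data of `F` can be read off from
its action on multimaps once the maps `lam` are invertible. -/
theorem mapMulti_lam_tensor (a b : C.carrier) :
    F.mapMulti (as := [a, b]) (tensorHom (lam a) (𝟙 b)) =
      tensorHom (lam (F.functor.obj a)) (𝟙 (F.functor.obj b)) ≫ F.μ a b := by
  have h := F.μ_naturality (lam a) (𝟙 b)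
  have h' := F.mapMulti_lam (𝟙 a)
  rw [Category.comp_id, F.functor.map_id, Category.comp_id] at h'
  rw [F.functor.map_id] at h
  rw [mapMulti, εAct_pair, Category.assoc, ← h, reassoc_of% tensorHom_comp', Category.comp_id,
    ← h', mapMulti]

end LaxMonFunctor

namespace MonNatTrans

variable {F G : LaxMonFunctor C D}

theorem toMultiTrans_injective (hD : D.IsLeftNormal) :
    Function.Injective (toMultiTrans (F := F) (G := G)) := by
  intro s t h
  refine MonNatTrans.ext (NatTrans.ext (funext fun a => ?_))
  have := hD (F.functor.obj a)
  exact (cancel_epi (lam (F.functor.obj a))).1 (congrFun (congrArg MultiTrans.app h) a)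

theorem toMultiTrans_surjective (hD : D.IsLeftNormal) :
    Function.Surjective (toMultiTrans (F := F) (G := G)) := by
  intro ψ
  -- The only candidate, since the 2-cell induced by `t` has components `lam ≫ t a`.
  let t (a : C.carrier) : F.functor.obj a ⟶ G.functor.obj a :=
    haveI := hD (F.functor.obj a)
    inv (lam (F.functor.obj a)) ≫ ψ.app a
  let m (a : C.carrier) : MultiHom [F.functor.obj a] (G.functor.obj a) := lam _ ≫ t a
  have hm : ψ.app = m := by
    funext a
    have := hD (F.functor.obj a)
    exact (IsIso.hom_inv_id_assoc (lam (F.functor.obj a)) (ψ.app a)).symm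
  -- Multicategorical naturality with `lam` cancelled. Testing it on `lam a ≫ f`, on `𝟙 unit` and on
  -- `tensorHom (lam a) (𝟙 b)` gives naturality, the unit axiom and the tensor axiom respectively.
  have key {as : List C.carrier} {b : C.carrier} (f : MultiHom as b) :
      F.mapMulti f ≫ t b = actList unit (.unary (Hom := MultiHom) m as) ≫ G.mapMulti f := by
    have h : actList unit (.single (Hom := MultiHom) (F.mapMulti f)) ≫ m b =
        actList unit (.unary (Hom := MultiHom) m as) ≫ G.mapMulti f := by
      have := ψ.naturality f
      rw [hm] at this
      exact this
    rw [← h, actList_single, Category.assoc, show m b = lam (F.functor.obj b) ≫ t b from rfl,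
      reassoc_of% lam_naturality, reassoc_of% actUnit_lam]
  have h₁ (X : D.carrier) (a : C.carrier) :
      actList X (.unary (Hom := MultiHom) m [a]) = tensorHom (𝟙 X) (t a) :=
    (actList_single X (m a)).trans (actUnit_singleton_lam_comp X (t a))
  have h₂ (X : D.carrier) (a b : C.carrier) :
      actList X (.unary (Hom := MultiHom) m [a, b]) =
        tensorHom (tensorHom (𝟙 X) (t a)) (t b) := by
    refine (actList_cons_single X (m a) (m b)).trans ?_
    rw [actUnit_singleton_lam_comp, actUnit_singleton_lam_comp, actMap_cons, actMap_nil,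
      tensorHom_comp', Category.id_comp, Category.comp_id]
  refine ⟨⟨⟨t, fun a b f => ?_⟩, ?_, fun a b => ?_⟩, MultiTrans.ext hm.symm⟩
  · have := hD (F.functor.obj a)
    have h := key (as := [a]) (lam a ≫ f)
    rw [F.mapMulti_lam, G.mapMulti_lam, h₁, reassoc_of% lam_naturality, Category.assoc] at h
    exact (cancel_epi _).1 h
  · have h := key (as := []) (𝟙 unit)
    rw [F.mapMulti_id_unit, G.mapMulti_id_unit] at h
    exact h.trans (Category.id_comp _)
  · have := hD (F.functor.obj a)
    have h := key (as := [a, b]) (tensorHom (lam a) (𝟙 b))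
    rw [F.mapMulti_lam_tensor, G.mapMulti_lam_tensor, h₂, Category.assoc,
      reassoc_of% tensorHom_comp', lam_naturality, Category.comp_id, ← Category.id_comp (t b),
        tensorHom_comp, Category.assoc] at h
    exact (cancel_epi _).1 h

end MonNatTrans

end SkewMult

/-! ### Bijectivity on 1-cells -/

namespace SkewMult

open CategoryTheory SkewMonoidal

namespace MultiFunctor

variable {C D : SkewMonCat.{v, u}} (P : MultiFunctor (toMulticategory C) (toMulticategory D))

/-- The action on objects of a morphism between multicategories of skew monoidal categories. -/
abbrev onObj : C.carrier → D.carrier := P.obj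

/-- The action on multimaps of a morphism between multicategories of skew monoidal categories. -/
def onMulti {as : List C.carrier} {b : C.carrier} (f : MultiHom as b) :
    MultiHom (as.map P.onObj) (P.onObj b) :=
  P.map f

theorem onMulti_lam (a : C.carrier) : P.onMulti (as := [a]) (lam a) = lam (P.onObj a) :=
  P.map_one a

theorem onMulti_comp {as bs : List C.carrier} {c : C.carrier} (g : MultiHom bs c)
    (fs : HomList (MultiHom (C := C.carrier)) as bs) :
    P.onMulti (actList unit fs ≫ g) =
      actList unit (fs.map (Hom' := MultiHom) P.onObj P.onMulti) ≫ P.onMulti g :=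
  P.map_comp g fs

variable [∀ a : D.carrier, IsIso (lam a)]

/-- The action on morphisms of a morphism between multicategories of skew monoidal categories. -/
noncomputable def unaryMap {a b : C.carrier} (f : a ⟶ b) : P.onObj a ⟶ P.onObj b :=
  inv (lam (P.onObj a)) ≫ P.onMulti (as := [a]) (lam a ≫ f)

theorem onMulti_lam_comp {a b : C.carrier} (f : a ⟶ b) :
    P.onMulti (as := [a]) (lam a ≫ f) = lam (P.onObj a) ≫ P.unaryMap f :=
  (IsIso.hom_inv_id_assoc (lam (P.onObj a)) _).symm

/-- Postcomposing with `f` is substituting into the unary multimap `lam b ≫ f`, which `P` preserves.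
-/
theorem onMulti_postcomp {as : List C.carrier} {b c : C.carrier} (g : MultiHom as b)
    (f : b ⟶ c) : P.onMulti (g ≫ f) = P.onMulti g ≫ P.unaryMap f := by
  have h : g ≫ f = actList unit (.single (Hom := MultiHom) g) ≫ lam b ≫ f := by
    rw [actList_single, Category.assoc, reassoc_of% lam_naturality, reassoc_of% actUnit_lam]
  have h' : actList unit (.single (Hom := MultiHom) (P.onMulti g)) ≫ lam _ ≫ P.unaryMap f =
      P.onMulti g ≫ P.unaryMap f := by
    rw [actList_single, Category.assoc, reassoc_of% lam_naturality, reassoc_of% actUnit_lam]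
  rw [h, ← h', ← onMulti_lam_comp]
  exact P.onMulti_comp (bs := [b]) (lam b ≫ f) (.single (Hom := MultiHom) g)

theorem unaryMap_id (a : C.carrier) : P.unaryMap (𝟙 a) = 𝟙 (P.onObj a) := by
  rw [unaryMap, Category.comp_id, onMulti_lam, IsIso.inv_hom_id]

theorem unaryMap_comp {a b c : C.carrier} (f : a ⟶ b) (g : b ⟶ c) :
    P.unaryMap (f ≫ g) = P.unaryMap f ≫ P.unaryMap g := by
  have h := P.onMulti_postcomp (as := [a]) (lam a ≫ f) g
  rw [Category.assoc] at h
  rw [unaryMap, unaryMap, Category.assoc, h]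

/-- The image of the universal multimap `as ⟶ (i ⊗ a₁) ⊗ ⋯ ⊗ aₙ`. -/
def univ (as : List C.carrier) : act unit (as.map P.onObj) ⟶ P.onObj (act unit as) :=
  P.onMulti (𝟙 (act unit as))

theorem onMulti_eq {as : List C.carrier} {b : C.carrier} (f : MultiHom as b) :
    P.onMulti f = P.univ as ≫ P.unaryMap f := by
  rw [univ, ← onMulti_postcomp, Category.id_comp]

/-- The tensor comparison maps of the lax monoidal functor given by a morphism of
multicategories. -/
noncomputable def laxμ (a b : C.carrier) : tensor (P.onObj a) (P.onObj b) ⟶ P.onObj (tensor a b) :=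
  tensorHom (inv (lam (P.onObj a))) (𝟙 (P.onObj b)) ≫
    P.onMulti (as := [a, b]) (tensorHom (lam a) (𝟙 b))

theorem onMulti_lam_tensor (a b : C.carrier) :
    P.onMulti (as := [a, b]) (tensorHom (lam a) (𝟙 b)) =
      tensorHom (lam (P.onObj a)) (𝟙 (P.onObj b)) ≫ P.laxμ a b := by
  rw [laxμ, reassoc_of% tensorHom_comp', IsIso.hom_inv_id, Category.comp_id, tensorHom_id,
    Category.id_comp]

/-- Preservation of the substitution of `k` and an identity into the universal bimap of `x` and `b`.
-/
theorem onMulti_append {as as₁ : List C.carrier} {x b : C.carrier} (h : as = as₁ ++ [b])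
    (k : act unit as₁ ⟶ x) :
    P.onMulti (actSplit h unit ≫ tensorHom k (𝟙 b)) =
      actSplit (as₂ := [P.onObj b]) (actSplit_map P.onObj h) unit ≫
        tensorHom (P.onMulti k) (𝟙 _) ≫ P.laxμ x b := by
  have h₁ := P.onMulti_comp (bs := [x, b]) (tensorHom (lam x) (𝟙 b))
    (.cons (Hom := MultiHom) h k (.single (Hom := MultiHom) (as := [b]) (lam b)))
  have h₂ : actList unit (.cons (Hom := MultiHom) (as₂ := [P.onObj b]) (actSplit_map P.onObj h)
        (P.onMulti k) (.single (P.onMulti (as := [b]) (lam b)))) ≫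
        P.onMulti (as := [x, b]) (tensorHom (lam x) (𝟙 b)) =
      actSplit (as₂ := [P.onObj b]) (actSplit_map P.onObj h) unit ≫
        tensorHom (P.onMulti k) (𝟙 _) ≫ P.laxμ x b := by
    rw [onMulti_lam, actList_append_lam, onMulti_lam_tensor, Category.assoc,
      reassoc_of% tensorHom_comp', Category.assoc, lam_naturality, reassoc_of% actUnit_lam,
      Category.comp_id]
  rw [← h₂]
  refine Eq.trans (congrArg P.onMulti ?_) h₁
  rw [actList_append_lam, Category.assoc, tensorHom_comp', Category.assoc, lam_naturality,
    reassoc_of% actUnit_lam, Category.comp_id]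

/-- Preservation of the substitution of `lam a ≫ f` and `g` into the universal bimap. Choosing `g`
unary, binary or nullary gives naturality of `laxμ`, half of its associativity, and its right unit
law. -/
theorem onMulti_cons {a a' b : C.carrier} {as : List C.carrier} (f : a ⟶ a')
    (g : MultiHom as b) :
    P.onMulti (as := a :: as)
        (actMap (lam a ≫ f) as ≫ actUnit a' as ≫ tensorHom (𝟙 a') g) =
      actMap (lam _ ≫ P.unaryMap f) (as.map P.onObj) ≫ actUnit (P.onObj a') (as.map P.onObj) ≫
        tensorHom (𝟙 _) (P.onMulti g) ≫ P.laxμ a' b := by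
  have h₁ := P.onMulti_comp (bs := [a', b]) (tensorHom (lam a') (𝟙 b))
    (.cons (Hom := MultiHom) (as := a :: as) (as₁ := [a]) rfl (lam a ≫ f) (.single g))
  have h₂ : actList unit (.cons (Hom := MultiHom) (as := P.onObj a :: as.map P.onObj)
        (as₁ := [P.onObj a]) rfl (P.onMulti (as := [a]) (lam a ≫ f)) (.single (P.onMulti g))) ≫
        P.onMulti (as := [a', b]) (tensorHom (lam a') (𝟙 b)) =
      actMap (lam _ ≫ P.unaryMap f) (as.map P.onObj) ≫ actUnit (P.onObj a') (as.map P.onObj) ≫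
        tensorHom (𝟙 _) (P.onMulti g) ≫ P.laxμ a' b := by
    rw [onMulti_lam_comp, onMulti_lam_tensor, reassoc_of% actList_cons_single_lam]
  rw [← h₂]
  exact (congrArg P.onMulti (actList_cons_single_lam f g).symm).trans h₁

theorem laxμ_naturality_left {a a' : C.carrier} (f : a ⟶ a') (b : C.carrier) :
    tensorHom (P.unaryMap f) (𝟙 _) ≫ P.laxμ a' b = P.laxμ a b ≫ P.unaryMap (tensorHom f (𝟙 b)) := by
  have h : P.onMulti (as := [a, b]) (tensorHom (lam a ≫ f) (𝟙 b) ≫ 𝟙 (tensor a' b)) =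
      tensorHom (lam _ ≫ P.unaryMap f) (𝟙 _) ≫ P.laxμ a' b := by
    rw [← actUnit_singleton_lam,
      ← (reassoc_of% actUnit_singleton_lam (P.onObj a') (P.onObj b)) (P.laxμ a' b), ←
        P.onMulti_lam b]
    exact P.onMulti_cons (as := [b]) f (lam b)
  rw [Category.comp_id, tensorHom_split, tensorHom_split, onMulti_postcomp,
    onMulti_lam_tensor, Category.assoc, Category.assoc] at h
  exact ((cancel_epi _).1 h).symm

theorem laxμ_naturality_right (a : C.carrier) {b b' : C.carrier} (g : b ⟶ b') :
    tensorHom (𝟙 _) (P.unaryMap g) ≫ P.laxμ a b' = P.laxμ a b ≫ P.unaryMap (tensorHom (𝟙 a) g) := by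
  have h : P.onMulti (as := [a, b]) (tensorHom (lam a) (𝟙 b) ≫ tensorHom (𝟙 a) g) =
      tensorHom (lam _) (𝟙 _) ≫ tensorHom (𝟙 _) (P.unaryMap g) ≫ P.laxμ a b' := by
    rw [← actUnit_singleton_lam_comp, ← reassoc_of% actUnit_singleton_lam_comp, ← onMulti_lam_comp]
    have := P.onMulti_cons (as := [b]) (𝟙 a) (lam b ≫ g)
    rw [unaryMap_id, Category.comp_id, Category.comp_id] at this
    exact this
  rw [onMulti_postcomp, onMulti_lam_tensor, Category.assoc] at h
  exact ((cancel_epi _).1 h).symm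

theorem laxμ_naturality {a a' b b' : C.carrier} (f : a ⟶ a') (g : b ⟶ b') :
    tensorHom (P.unaryMap f) (P.unaryMap g) ≫ P.laxμ a' b' =
      P.laxμ a b ≫ P.unaryMap (tensorHom f g) := by
  have h : tensorHom f g = tensorHom f (𝟙 b) ≫ tensorHom (𝟙 a') g := by
    rw [tensorHom_comp', Category.comp_id, Category.id_comp]
  rw [h, unaryMap_comp, ← reassoc_of% P.laxμ_naturality_left, ← P.laxμ_naturality_right,
    reassoc_of% tensorHom_comp', Category.comp_id, Category.id_comp]

/-- The ternary multimap `((lam a ⊗ 𝟙) ⊗ 𝟙) ≫ α` is evaluated twice: as the universal bimap of `a`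
and `b ⊗ c` with a bimap substituted on the right, and as a bimap substituted on the left followed
by `α`. The common invertible factor is then cancelled. -/
theorem laxμ_assoc (a b c : C.carrier) :
    tensorHom (P.laxμ a b) (𝟙 (P.onObj c)) ≫ P.laxμ (tensor a b) c ≫ P.unaryMap (α a b c) =
      α (P.onObj a) (P.onObj b) (P.onObj c) ≫
        tensorHom (𝟙 (P.onObj a)) (P.laxμ b c) ≫ P.laxμ a (tensor b c) := by
  have h : P.onMulti (as := [a, b, c]) (tensorHom (tensorHom (lam a) (𝟙 b)) (𝟙 c) ≫ α a b c) =
      tensorHom (tensorHom (lam _) (𝟙 _)) (𝟙 _) ≫ α _ _ _ ≫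
        tensorHom (𝟙 (P.onObj a)) (P.laxμ b c) ≫ P.laxμ a (tensor b c) := by
    have := P.onMulti_cons (as := [b, c]) (𝟙 a) (tensorHom (lam b) (𝟙 c))
    rw [unaryMap_id, Category.comp_id, Category.comp_id, actUnit_pair, onMulti_lam_tensor,
      tensorHom_split'] at this
    rw [← actUnit_pair (P.onObj a)]
    simp only [Category.assoc]
    simp only [Category.assoc] at this
    exact this
  have h' : P.onMulti (as := [a, b, c]) (𝟙 _ ≫ tensorHom (tensorHom (lam a) (𝟙 b)) (𝟙 c)) =
      𝟙 _ ≫ tensorHom (P.onMulti (as := [a, b]) (tensorHom (lam a) (𝟙 b))) (𝟙 _) ≫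
        P.laxμ (tensor a b) c :=
    P.onMulti_append (as := [a, b, c]) (as₁ := [a, b]) rfl (tensorHom (lam a) (𝟙 b))
  rw [Category.id_comp, Category.id_comp, onMulti_lam_tensor, tensorHom_split, Category.assoc] at h'
  rw [onMulti_postcomp, h', Category.assoc, Category.assoc] at h
  exact (cancel_epi _).1 h

theorem laxμ_rho (a : C.carrier) :
    rho (P.onObj a) ≫ tensorHom (𝟙 (P.onObj a)) (P.univ []) ≫ P.laxμ a unit =
      P.unaryMap (rho a) := by
  -- The extra identities are what `actUnit` on the empty list and `tensorHom` of two identities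
  -- leave behind; keeping them lets `onMulti_cons` match definitionally.
  have h : P.onMulti (as := [a]) (lam a ≫ (rho a ≫ 𝟙 _) ≫ 𝟙 (tensor a unit)) =
      lam _ ≫ (rho _ ≫ 𝟙 _) ≫ tensorHom (𝟙 (P.onObj a)) (P.univ []) ≫ P.laxμ a unit := by
    have := P.onMulti_cons (as := []) (𝟙 a) (𝟙 unit)
    rw [unaryMap_id, Category.comp_id, Category.comp_id, tensorHom_id] at this
    exact this
  rw [Category.comp_id, Category.comp_id, Category.comp_id, onMulti_lam_comp] at h
  exact ((cancel_epi _).1 h).symm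

theorem laxμ_lam (a : C.carrier) :
    tensorHom (P.univ []) (𝟙 (P.onObj a)) ≫ P.laxμ unit a ≫ P.unaryMap (lam a) =
      lam (P.onObj a) := by
  have h : P.onMulti (as := [a]) (𝟙 _ ≫ tensorHom (𝟙 unit) (𝟙 a)) =
      𝟙 _ ≫ tensorHom (P.univ []) (𝟙 _) ≫ P.laxμ unit a :=
    P.onMulti_append (as := [a]) (as₁ := []) rfl (𝟙 unit)
  rw [Category.id_comp, Category.id_comp] at h
  rw [← reassoc_of% h, ← onMulti_postcomp, tensorHom_id, Category.id_comp, onMulti_lam]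

/-- The lax monoidal functor given by a morphism of multicategories. -/
noncomputable def toLaxMonFunctor : LaxMonFunctor C D where
  functor :=
    { obj := P.onObj
      map := P.unaryMap
      map_id := P.unaryMap_id
      map_comp := P.unaryMap_comp }
  ε := P.univ []
  μ := P.laxμ
  μ_naturality := P.laxμ_naturality
  associativity := P.laxμ_assoc
  left_unitality := P.laxμ_lam
  right_unitality := P.laxμ_rho

theorem toLaxMonFunctor_εAct (as : List C.carrier) : P.toLaxMonFunctor.εAct as = P.univ as := by
  -- Induction is from the right: tensoring is bracketed to the left, so `εAct` and `univ` both
  -- satisfy the same recursion on appending an object.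
  induction as using List.reverseRecOn with
  | nil =>
    exact Category.comp_id (P.univ [])
  | append_singleton as b ih =>
    have h₁ := P.toLaxMonFunctor.εAct_append as b
    have h₂ := P.onMulti_append (as := as ++ [b]) (as₁ := as) rfl (𝟙 (act unit as))
    rw [tensorHom_id, Category.comp_id, onMulti_eq] at h₂
    rw [ih] at h₁
    exact (cancel_mono (P.toLaxMonFunctor.functor.map
      (actSplit (as := as ++ [b]) (as₂ := [b]) rfl unit))).1 (h₁.trans h₂.symm)

theorem toLaxMonFunctor_toMultiFunctor : P.toLaxMonFunctor.toMultiFunctor = P := by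
  refine MultiFunctor.eq_of rfl fun as b f => heq_of_eq ?_
  refine Eq.trans ?_ (P.onMulti_eq f).symm
  exact congrArg (· ≫ P.unaryMap f) (P.toLaxMonFunctor_εAct as)

end MultiFunctor

theorem LaxMonFunctor.toMultiFunctor_toLaxMonFunctor {C D : SkewMonCat.{v, u}}
    [∀ a : D.carrier, IsIso (lam a)] (F : LaxMonFunctor C D) :
    F.toMultiFunctor.toLaxMonFunctor = F := by
  refine LaxMonFunctor.eq_of ?_ (heq_of_eq F.mapMulti_id_unit) fun a b => heq_of_eq ?_
  · refine CategoryTheory.Functor.hext (fun _ => rfl) fun a b f => heq_of_eq ?_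
    refine (cancel_epi (lam (F.functor.obj a))).1 ?_
    exact (IsIso.hom_inv_id_assoc _ _).trans (F.mapMulti_lam f)
  · refine (cancel_epi (tensorHom (lam (F.functor.obj a)) (𝟙 (F.functor.obj b)))).1 ?_
    exact (F.toMultiFunctor.onMulti_lam_tensor a b).symm.trans (F.mapMulti_lam_tensor a b)

end SkewMult

/-! ### Substitution into composites in a multicategory -/

namespace SkewMult

open CategoryTheory SkewMonoidal

namespace HomList

variable {A : Type u} {Hom : List A → A → Type v}

/-- Concatenation of lists of multimaps. -/
def append : ∀ {as₁ as₂ bs₁ bs₂ : List A}, HomList Hom as₁ bs₁ → HomList Hom as₂ bs₂ →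
    HomList Hom (as₁ ++ as₂) (bs₁ ++ bs₂)
  | _, _, _, _, nil, gs => gs
  | _, _, _, _, cons h f fs, gs => cons (by rw [h, List.append_assoc]) f (append fs gs)

theorem split_append {as₁ as₂ bs₁ bs₂ : List A} (fs : HomList Hom as₁ bs₁)
    (gs : HomList Hom as₂ bs₂) : split bs₁ (append fs gs) = ⟨as₁, as₂, rfl, fs, gs⟩ := by
  induction fs with
  | nil => rfl
  | @cons as as' as'' b bs h f fs ih =>
    subst h
    exact congrArg (fun s : Splitting Hom _ bs bs₂ =>
      (⟨as' ++ s.left, s.right, by rw [List.append_assoc, List.append_assoc, ← s.eq],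
        cons rfl f s.fst, s.snd⟩ : Splitting Hom _ (b :: bs) bs₂)) ih

theorem append_ones (one : ∀ a, Hom [a] a) (as bs : List A) :
    append (ones one as) (ones one bs) = ones one (as ++ bs) := by
  induction as with
  | nil => rfl
  | cons a as ih => exact congrArg (cons (as₁ := [a]) rfl (one a)) ih

end HomList

namespace Multicategory

variable (M : Multicategory.{v, u})

theorem one_comp_heq {as as₁ : List M.Obj} {b : M.Obj} (h : as = as₁ ++ []) (f : M.Hom as₁ b) :
    M.comp (M.one b) (.cons h f .nil) ≍ f := by
  obtain rfl : as = as₁ := h.trans (List.append_nil as₁)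
  exact heq_of_eq (M.one_comp f)

theorem ones_subst {as bs : List M.Obj} (fs : HomList M.Hom as bs) :
    (HomList.ones M.one bs).subst M.comp fs = fs := by
  induction fs with
  | nil => rfl
  | cons h f fs ih =>
    exact eq_of_heq (HomList.cons_heq (List.append_nil _) rfl rfl rfl (M.one_comp_heq rfl f)
      (heq_of_eq ih))

theorem comp_single_assoc {as bs : List M.Obj} {c d : M.Obj} (g : M.Hom [c] d) (x : M.Hom bs c)
    (fs : HomList M.Hom as bs) :
    M.comp (M.comp g (.single x)) fs = M.comp g (.single (M.comp x fs)) := by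
  rw [M.assoc, subst_single]

/-- The associativity law hides the blocks inside `HomList.split`; for a list given as a
concatenation they are computed. The nullary, unary and binary cases below are the ones used. -/
theorem comp_cons_append {as₁ as₂ bs₁ bs₂ cs : List M.Obj} {c d : M.Obj} (g : M.Hom (c :: cs) d)
    (x : M.Hom bs₁ c) (gs : HomList M.Hom bs₂ cs) (fs₁ : HomList M.Hom as₁ bs₁)
    (fs₂ : HomList M.Hom as₂ bs₂) :
    M.comp (M.comp g (.cons rfl x gs)) (fs₁.append fs₂) =
      M.comp g (.cons rfl (M.comp x fs₁) (gs.subst M.comp fs₂)) := by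
  rw [M.assoc]
  exact congrArg (fun s : HomList.Splitting M.Hom _ bs₁ bs₂ =>
    M.comp g (.cons s.eq (M.comp x s.fst) (gs.subst M.comp s.snd))) (HomList.split_append fs₁ fs₂)

theorem comp_cons_nullary {as cs : List M.Obj} {c d : M.Obj} (g : M.Hom (c :: cs) d)
    (x : M.Hom [] c) {bs : List M.Obj} (gs : HomList M.Hom bs cs) (fs : HomList M.Hom as bs) :
    M.comp (M.comp g (.cons rfl x gs)) fs =
      M.comp g (.cons rfl x (gs.subst M.comp fs)) := by
  exact (M.comp_cons_append g x gs .nil fs).trans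
    (congrArg (fun y => M.comp g (.cons rfl y (gs.subst M.comp fs))) (M.comp_one x))

theorem comp_cons_unary {as as₁ as₂ bs cs : List M.Obj} {b c d : M.Obj} (g : M.Hom (c :: cs) d)
    (x : M.Hom [b] c) (gs : HomList M.Hom bs cs) (h : as = as₁ ++ as₂) (f : M.Hom as₁ b)
    (fs : HomList M.Hom as₂ bs) :
    M.comp (M.comp g (.cons (as := b :: bs) rfl x gs)) (.cons h f fs) =
      M.comp g (.cons h (M.comp x (.single f)) (gs.subst M.comp fs)) := by
  subst h
  exact M.comp_cons_append g x gs (.single f) fs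

theorem comp_cons_binary {as as₁ as₂ as₃ as₁₂ as₂₃ bs cs : List M.Obj} {a b c d : M.Obj}
    (g : M.Hom (c :: cs) d) (x : M.Hom [a, b] c) (gs : HomList M.Hom bs cs)
    (h₁ : as = as₁ ++ as₂₃) (f₁ : M.Hom as₁ a) (h₂ : as₂₃ = as₂ ++ as₃) (f₂ : M.Hom as₂ b)
    (fs : HomList M.Hom as₃ bs) (h₃ : as = as₁₂ ++ as₃) (h₄ : as₁₂ = as₁ ++ as₂) :
    M.comp (M.comp g (.cons (as := a :: b :: bs) rfl x gs)) (.cons h₁ f₁ (.cons h₂ f₂ fs)) =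
      M.comp g (.cons h₃ (M.comp x (.cons h₄ f₁ (.single f₂))) (gs.subst M.comp fs)) := by
  subst h₃ h₄ h₂
  exact M.comp_cons_append g x gs (.cons rfl f₁ (.single f₂)) fs

end Multicategory

end SkewMult

/-! ### The skew monoidal structure given by left universal multimaps -/

namespace SkewMult

open CategoryTheory SkewMonoidal

namespace Multicategory

variable {M : Multicategory.{v, u}}

/-- Left universality of a multimap `x : as ⟶ m`. -/
def IsLeftUniversal {as : List M.Obj} {m : M.Obj} (x : M.Hom as m) : Prop :=
  ∀ (bs cs : List M.Obj) (h : cs = as ++ bs) (c : M.Obj),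
    Function.Bijective fun g : M.Hom (m :: bs) c => M.comp g (.cons h x (.ones M.one bs))

namespace IsLeftUniversal

variable {as : List M.Obj} {m : M.Obj} {x : M.Hom as m}

theorem of_precomp (hx : ∀ bs c, Function.Bijective (M.precomp x bs c)) : IsLeftUniversal x := by
  intro bs cs h c
  subst h
  exact hx bs c

theorem hom_ext (hx : IsLeftUniversal x) {c : M.Obj} {g g' : M.Hom [m] c}
    (h : M.comp g (.single x) = M.comp g' (.single x)) : g = g' :=
  (hx [] as (List.append_nil as).symm c).1 h

/-- The factorization of a multimap through a left universal multimap. -/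
noncomputable def desc (hx : IsLeftUniversal x) {bs cs : List M.Obj} (h : cs = as ++ bs)
    {c : M.Obj} (k : M.Hom cs c) : M.Hom (m :: bs) c :=
  ((hx bs cs h c).2 k).choose

theorem fac (hx : IsLeftUniversal x) {bs cs : List M.Obj} (h : cs = as ++ bs)
    {c : M.Obj} (k : M.Hom cs c) :
    M.comp (hx.desc h k) (.cons h x (.ones M.one bs)) = k :=
  ((hx bs cs h c).2 k).choose_spec

theorem one (a : M.Obj) : IsLeftUniversal (M.one a) := by
  intro bs cs h c
  subst h
  convert Function.bijective_id using 1
  funext g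
  exact M.comp_one g

/-- Precomposition with the composite is a composite of two bijections. The trailing variables in
the definition are essential: `x` is used with `bs ++ ds` on its right. -/
theorem comp (hx : IsLeftUniversal x) {bs cs : List M.Obj} {c : M.Obj} {y : M.Hom (m :: bs) c}
    (hy : IsLeftUniversal y) (h : cs = as ++ bs) :
    IsLeftUniversal (M.comp y (.cons h x (.ones M.one bs))) := by
  intro ds es h' e
  subst h h'
  convert (hx (bs ++ ds) (as ++ bs ++ ds) (List.append_assoc _ _ _) e).comp (hy ds _ rfl e) using 1
  funext g
  have := M.comp_cons_append g y (.ones M.one ds) (.cons rfl x (.ones M.one bs)) (.ones M.one ds)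
  rw [ones_subst] at this
  rw [← this]
  exact congrArg (fun k => M.comp (M.comp g (.cons rfl y (.ones M.one ds)))
    (.cons (List.append_assoc _ _ _) x k)) (HomList.append_ones M.one bs ds)

end IsLeftUniversal

variable (M) in
/-- A choice of left universal multimaps out of the empty list and out of lists of length two. -/
class UniversalPairs where
  tensorObj : M.Obj → M.Obj → M.Obj
  pair (a b : M.Obj) : M.Hom [a, b] (tensorObj a b)
  unitObj : M.Obj
  nullary : M.Hom [] unitObj
  pair_isLeftUniversal (a b : M.Obj) : IsLeftUniversal (pair a b)
  nullary_isLeftUniversal : IsLeftUniversal nullary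

open UniversalPairs

instance [UniversalPairs M] : Category.{v} M.Obj where
  Hom a b := M.Hom [a] b
  id a := M.one a
  comp f g := M.comp g (.single f)
  id_comp f := M.comp_one f
  comp_id f := M.one_comp f
  assoc f g h := (M.comp_single_assoc h g (.single f)).symm

variable [UniversalPairs M]

/-- Postcomposition of a multimap with a morphism. -/
def post {as : List M.Obj} {a b : M.Obj} (f : a ⟶ b) (x : M.Hom as a) : M.Hom as b :=
  M.comp (bs := [a]) f (.single x)

@[simp]
theorem post_id {as : List M.Obj} {a : M.Obj} (x : M.Hom as a) : post (𝟙 a) x = x :=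
  M.one_comp x

@[simp]
theorem post_comp {as : List M.Obj} {a b c : M.Obj} (f : a ⟶ b) (g : b ⟶ c) (x : M.Hom as a) :
    post (f ≫ g) x = post g (post f x) :=
  M.comp_single_assoc (bs := [a]) g f (.single x)

theorem post_one {a b : M.Obj} (f : a ⟶ b) : post f (M.one a) = f :=
  M.comp_one (bs := [a]) f

/-- The multimap `θ(x, y)` with `θ` the universal bimap. -/
def tens {as as₁ as₂ : List M.Obj} {a b : M.Obj} (h : as = as₁ ++ as₂) (x : M.Hom as₁ a)
    (y : M.Hom as₂ b) : M.Hom as (tensorObj a b) :=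
  M.comp (pair a b) (.cons h x (.single y))

theorem tens_one (a b : M.Obj) : tens (as₁ := [a]) rfl (M.one a) (M.one b) = pair a b :=
  M.comp_one (pair a b)

theorem IsLeftUniversal.tens {as as₁ : List M.Obj} {a : M.Obj} {x : M.Hom as₁ a}
    (hx : IsLeftUniversal x) {b : M.Obj} (h : as = as₁ ++ [b]) :
    IsLeftUniversal (Multicategory.tens h x (M.one b)) :=
  hx.comp (pair_isLeftUniversal a b) h

/-- The morphism out of a tensor product induced by a bimap. -/
noncomputable def descPair {a b c : M.Obj} (k : M.Hom [a, b] c) : tensorObj a b ⟶ c :=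
  (pair_isLeftUniversal a b).desc (bs := []) rfl k

/-- The factorization property on generalized elements `x`, `y`. The `post_` rules for the structure
maps have this shape, so the axioms can be checked by rewriting. -/
theorem post_descPair_tens {as as₁ as₂ : List M.Obj} {a b c : M.Obj} (k : M.Hom [a, b] c)
    (h : as = as₁ ++ as₂) (x : M.Hom as₁ a) (y : M.Hom as₂ b) :
    post (descPair k) (tens h x y) = M.comp k (.cons h x (.single y)) := by
  have := (pair_isLeftUniversal a b).fac (bs := []) rfl k
  rw [post, tens, ← comp_single_assoc]
  exact congrArg (fun k => M.comp k (.cons h x (.single y))) this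

/-- Functoriality of the tensor product. -/
noncomputable def mapPair {a a' b b' : M.Obj} (f : a ⟶ a') (g : b ⟶ b') :
    tensorObj a b ⟶ tensorObj a' b' :=
  descPair (tens (as₁ := [a]) (as₂ := [b]) rfl f g)

theorem post_mapPair {a a' b b' : M.Obj} (f : a ⟶ a') (g : b ⟶ b') {as as₁ as₂ : List M.Obj}
    (h : as = as₁ ++ as₂) (x : M.Hom as₁ a) (y : M.Hom as₂ b) :
    post (mapPair f g) (tens h x y) = tens h (post f x) (post g y) := by
  rw [mapPair, post_descPair_tens]
  refine (M.comp_cons_unary (bs := [b]) (pair a' b') f (.single g) h x (.single y)).trans ?_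
  rw [subst_single]
  rfl

/-- The associator. -/
noncomputable def assocPair (a b c : M.Obj) :
    tensorObj (tensorObj a b) c ⟶ tensorObj a (tensorObj b c) :=
  -- Left universality with the trailing variable `c` is what allows the pair `a, b` inside a
  -- ternary multimap to be replaced by its tensor product.
  descPair ((pair_isLeftUniversal a b).desc (bs := [c]) (cs := [a, b, c]) rfl
    (tens (as₁ := [a]) rfl (M.one a) (pair b c)))

theorem post_assocPair {a b c : M.Obj} {as as₁ as₂ as₃ as₁₂ as₂₃ : List M.Obj}
    (h : as = as₁₂ ++ as₃) (h' : as₁₂ = as₁ ++ as₂) (x : M.Hom as₁ a) (y : M.Hom as₂ b)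
    (z : M.Hom as₃ c) (k' : as₂₃ = as₂ ++ as₃) (k : as = as₁ ++ as₂₃) :
    post (assocPair a b c) (tens h (tens h' x y) z) = tens k x (tens k' y z) := by
  have e := (pair_isLeftUniversal a b).fac (bs := [c]) (cs := [a, b, c]) rfl
    (tens (as₁ := [a]) rfl (M.one a) (pair b c))
  have e₁ := M.comp_cons_binary ((pair_isLeftUniversal a b).desc (bs := [c]) (cs := [a, b, c]) rfl
    (tens (as₁ := [a]) rfl (M.one a) (pair b c))) (pair a b) (.ones M.one [c]) k x k' y (.single z)
    h h'
  rw [ones_subst] at e₁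
  rw [assocPair, post_descPair_tens]
  refine e₁.symm.trans ((congrArg (fun g => M.comp g _) e).trans ?_)
  refine (M.comp_cons_unary (bs := [b, c]) (pair a (tensorObj b c)) (M.one a)
    (.single (pair b c)) k x (.cons k' y (.single z))).trans ?_
  rw [subst_single, M.one_comp]
  rfl

/-- The left unit map. -/
noncomputable def lamPair (a : M.Obj) : tensorObj (unitObj (M := M)) a ⟶ a :=
  -- The identity of `a` is read as a multimap out of `[] ++ [a]` and factored through the nullary
  -- universal multimap.
  descPair (nullary_isLeftUniversal.desc (bs := [a]) rfl (M.one a))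

theorem post_lamPair {a : M.Obj} {as : List M.Obj} (h : as = [] ++ as) (x : M.Hom as a) :
    post (lamPair a) (tens h nullary x) = x := by
  have e := nullary_isLeftUniversal.fac (bs := [a]) rfl (M.one a)
  rw [lamPair, post_descPair_tens]
  have e₁ := M.comp_cons_nullary (nullary_isLeftUniversal.desc (bs := [a]) rfl (M.one a)) nullary
    (.ones M.one [a]) (.single x)
  rw [ones_subst] at e₁
  exact e₁.symm.trans ((congrArg (fun g => M.comp g _) e).trans (M.one_comp x))

/-- The right unit map. -/
def rhoPair (a : M.Obj) : a ⟶ tensorObj a unitObj := tens (as₁ := [a]) rfl (M.one a) nullary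

theorem post_rhoPair {a : M.Obj} {as : List M.Obj} (x : M.Hom as a) (h : as = as ++ []) :
    post (rhoPair a) x = tens h x nullary := by
  refine (M.comp_cons_unary (bs := []) (pair a unitObj) (M.one a) (.single nullary) h x
    .nil).trans ?_
  rw [subst_single, M.one_comp]
  exact congrArg (fun y => tens h x y) (M.comp_one nullary)

/-- Each axiom compares two morphisms with the same source. `hom_ext` reduces it to their values on
a left universal multimap into that source (an iterate of `pair` and `nullary`, or an identity),
where the `post_` rules bring both sides to the same form. -/
noncomputable instance : SkewMonoidal M.Obj where
  tensor := tensorObj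
  unit := unitObj
  tensorHom := mapPair
  α := assocPair
  lam := lamPair
  rho := rhoPair
  tensorHom_id a b := by
    refine (pair_isLeftUniversal a b).hom_ext (?_ : post _ _ = post _ _)
    rw [← tens_one, post_mapPair, post_id, post_id, post_id]
  tensorHom_comp f f' g g' := by
    refine (pair_isLeftUniversal _ _).hom_ext (?_ : post _ _ = post _ _)
    rw [← tens_one, post_comp, post_mapPair, post_mapPair, post_mapPair, post_comp, post_comp]
  α_naturality {a a' b b' c c'} f g h := by
    refine ((pair_isLeftUniversal a b).tens (as := [a, b, c]) rfl).hom_ext (?_ : post _ _ = post _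
      _)
    rw [← tens_one, post_comp, post_comp, post_mapPair, post_mapPair,
      post_assocPair (as₂₃ := [b, c]),
      post_assocPair (as₂₃ := [b, c]), post_mapPair, post_mapPair]
    all_goals rfl
  lam_naturality {a a'} f := by
    refine (nullary_isLeftUniversal.tens (as := [a]) rfl).hom_ext (?_ : post _ _ = post _ _)
    rw [post_comp, post_comp, post_mapPair, post_lamPair, post_id, post_lamPair]
  rho_naturality {a a'} f := by
    refine (IsLeftUniversal.one a).hom_ext (?_ : post _ _ = post _ _)
    rw [post_comp, post_comp, post_rhoPair _ rfl, post_rhoPair _ rfl, post_mapPair, post_id]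
  pentagon a b c d := by
    refine (((pair_isLeftUniversal a b).tens (as := [a, b, c]) rfl).tens
      (as := [a, b, c, d]) rfl).hom_ext (?_ : post _ _ = post _ _)
    rw [← tens_one, post_comp, post_comp, post_comp, post_mapPair,
      post_assocPair (as₂₃ := [b, c]),
      post_assocPair (as₂₃ := [b, c, d]), post_mapPair,
      post_assocPair (as₂₃ := [c, d]),
      post_assocPair (as₂₃ := [c, d]),
      post_assocPair (as₂₃ := [b, c, d]), post_id, post_id]
    all_goals rfl
  α_lam a b := by
    refine ((nullary_isLeftUniversal.tens (as := [a]) rfl).tens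
      (as := [a, b]) rfl).hom_ext (?_ : post _ _ = post _ _)
    rw [post_comp, post_assocPair (as₂₃ := [a, b]), post_lamPair,
      post_mapPair, post_lamPair, post_id]
    all_goals rfl
  triangle a b := by
    refine (pair_isLeftUniversal a b).hom_ext (?_ : post _ _ = post _ _)
    rw [← tens_one, post_comp, post_comp, post_mapPair, post_rhoPair _ rfl, post_id,
      post_assocPair (as₂₃ := [b]), post_mapPair, post_lamPair, post_id,
      post_id]
    all_goals rfl
  rho_α a b := by
    refine (pair_isLeftUniversal a b).hom_ext (?_ : post _ _ = post _ _)
    rw [← tens_one, post_comp, post_rhoPair _ rfl,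
      post_assocPair (as₂₃ := [b]), post_mapPair, post_rhoPair _ rfl,
      post_id]
  rho_lam := by
    refine nullary_isLeftUniversal.hom_ext (?_ : post _ _ = post _ _)
    rw [post_comp, post_rhoPair _ rfl, post_lamPair, post_id]

end Multicategory

end SkewMult

/-! ### Multimaps as morphisms out of iterated tensor products -/

namespace SkewMult

open CategoryTheory SkewMonoidal

namespace Multicategory

variable {M : Multicategory.{v, u}} [UniversalPairs M]

open UniversalPairs

/-- The inverse exists because `tens nullary 1_a` has the one-element source `[a]`, hence is itself
a morphism `a ⟶ i ⊗ a`. -/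
theorem lam_isIso (a : M.Obj) : IsIso (lam a) := by
  refine ⟨(tens (as := [a]) rfl nullary (M.one a) : a ⟶ tensor unit a), ?_, ?_⟩
  · refine (nullary_isLeftUniversal.tens (as := [a]) rfl).hom_ext (?_ : post _ _ = post _ _)
    rw [post_comp, post_id]
    exact (congrArg (post _) (post_lamPair rfl (M.one a))).trans (post_one _)
  · refine (IsLeftUniversal.one a).hom_ext (?_ : post _ _ = post _ _)
    rw [post_comp, post_id, post_one]
    exact post_lamPair rfl (M.one a)

/-- The universal multimap `X, as ⟶ ((X ⊗ a₁) ⊗ ⋯) ⊗ aₙ`. -/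
noncomputable def spine : ∀ (X : M.Obj) (as : List M.Obj), M.Hom (X :: as) (act X as)
  | X, [] => M.one X
  | X, a :: as => M.comp (spine (tensor X a) as)
      (.cons (as := X :: a :: as) (as₁ := [X, a]) rfl (pair X a) (.ones M.one as))

theorem spine_isLeftUniversal (X : M.Obj) (as : List M.Obj) : IsLeftUniversal (spine X as) := by
  induction as generalizing X with
  | nil => exact IsLeftUniversal.one X
  | cons a as ih => exact (pair_isLeftUniversal X a).comp (ih (tensor X a)) rfl

/-- The multimap `((θ(x, f₁), f₂), …, fₙ)`. -/
noncomputable def tensList {as bs cs ds : List M.Obj} {X : M.Obj} (h : cs = ds ++ as) (x : M.Hom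
    ds X)
    (fs : HomList M.Hom as bs) : M.Hom cs (act X bs) :=
  M.comp (spine X bs) (.cons h x fs)

theorem tensList_nil {cs : List M.Obj} {X : M.Obj} (h : cs = cs ++ []) (x : M.Hom cs X) :
    tensList h x .nil = x :=
  M.one_comp x

theorem tensList_cons {as as₁ as₂ bs cs ds es : List M.Obj} {X b : M.Obj} (h : cs = ds ++ as)
    (x : M.Hom ds X) (h' : as = as₁ ++ as₂) (f : M.Hom as₁ b) (fs : HomList M.Hom as₂ bs)
    (k : cs = es ++ as₂) (k' : es = ds ++ as₁) :
    tensList h x (.cons h' f fs) = tensList k (tens k' x f) fs := by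
  have := M.comp_cons_binary (spine (tensor X b) bs) (pair X b) (.ones M.one bs) h x h' f fs k k'
  rw [ones_subst] at this
  exact this

theorem post_tensor {a a' b b' : M.Obj} (f : a ⟶ a') (g : b ⟶ b') {as as₁ as₂ : List M.Obj}
    (h : as = as₁ ++ as₂) (x : M.Hom as₁ a) (y : M.Hom as₂ b) :
    post (tensorHom f g) (tens h x y) = tens h (post f x) (post g y) :=
  post_mapPair f g h x y

theorem post_actMap {as bs cs ds : List M.Obj} {X Y : M.Obj} (f : X ⟶ Y) (h : cs = ds ++ as)
    (x : M.Hom ds X) (fs : HomList M.Hom as bs) :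
    post (actMap f bs) (tensList h x fs) = tensList h (post f x) fs := by
  induction fs generalizing X Y ds with
  | nil =>
    obtain rfl : cs = ds := by simpa using h
    rw [tensList_nil, tensList_nil]
    rfl
  | @cons as as₁ as₂ b bs h' g gs ih =>
    have k : cs = (ds ++ as₁) ++ as₂ := by rw [h, h', List.append_assoc]
    rw [actMap_cons, tensList_cons h x h' g gs k rfl, tensList_cons h _ h' g gs k rfl]
    have := ih (tensorHom f (𝟙 b)) k (tens rfl x g)
    rw [post_tensor, post_id] at this
    exact this

/-- Iterates `post_assocPair`. The decompositions of the source are left as free variables with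
equations so that the induction can rebracket them. -/
theorem post_actAssoc {as bs cs ds ds₁ ds₂ es : List M.Obj} {X Y : M.Obj} (h : cs = ds ++ as)
    (h' : ds = ds₁ ++ ds₂) (x : M.Hom ds₁ X) (y : M.Hom ds₂ Y) (fs : HomList M.Hom as bs)
    (k : cs = ds₁ ++ es) (k' : es = ds₂ ++ as) :
    post (actAssoc X Y bs) (tensList h (tens h' x y) fs) = tens k x (tensList k' y fs) := by
  induction fs generalizing Y ds ds₂ with
  | nil =>
    obtain rfl : cs = ds := by simpa using h
    obtain rfl : es = ds₂ := by simpa using k'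
    exact (congrArg (post _) (tensList_nil _ _)).trans
      ((post_id _).trans (congrArg (tens _ x) (tensList_nil _ _).symm))
  | @cons as as₁ as₂ b bs h₁ g gs ih =>
    have k₁ : cs = (ds ++ as₁) ++ as₂ := by rw [h, h₁, List.append_assoc]
    have k₂ : es = (ds₂ ++ as₁) ++ as₂ := by rw [k', h₁, List.append_assoc]
    rw [actAssoc_cons, post_comp, tensList_cons h _ h₁ g gs k₁ rfl,
      tensList_cons k' y h₁ g gs k₂ rfl, ← ih k₁ (by rw [h', List.append_assoc]) (tens rfl y g) k₂]
    refine congrArg (post _) ?_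
    have := post_actMap (α X Y b) k₁ (tens rfl (tens h' x y) g) gs
    rw [← post_assocPair rfl h']
    exact this

/-- The universal multimap `as ⟶ ((i ⊗ a₁) ⊗ ⋯) ⊗ aₙ`. -/
noncomputable def unitSpine (as : List M.Obj) : M.Hom as (act unit as) :=
  tensList (ds := []) rfl nullary (.ones M.one as)

theorem unitSpine_isLeftUniversal (as : List M.Obj) : IsLeftUniversal (unitSpine as) :=
  nullary_isLeftUniversal.comp (spine_isLeftUniversal unit as) rfl

theorem comp_unitSpine {as bs : List M.Obj} (fs : HomList M.Hom as bs) :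
    M.comp (unitSpine bs) fs = tensList (ds := []) rfl nullary fs := by
  have := M.comp_cons_nullary (spine unit bs) nullary (.ones M.one bs) fs
  rw [ones_subst] at this
  exact this

theorem post_actUnit {as cs ds : List M.Obj} {X : M.Obj} (h : cs = ds ++ as) (x : M.Hom ds X) :
    post (actUnit X as) (tensList h x (.ones M.one as)) = tens h x (unitSpine as) := by
  rw [actUnit, post_comp, post_actMap]
  have e : post (rho X) x = tens (List.append_nil _).symm x nullary := post_rhoPair x _
  rw [e]
  exact post_actAssoc h _ x nullary _ h rfl

theorem post_actSplit {as as₁ as₂ cs ds es : List M.Obj} {X : M.Obj} (h : cs = ds ++ as)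
    (x : M.Hom ds X) (h' : as = as₁ ++ as₂) (k : cs = es ++ as₂) (k' : es = ds ++ as₁) :
    post (actSplit h' X) (tensList h x (.ones M.one as)) =
      tensList k (tensList k' x (.ones M.one as₁)) (.ones M.one as₂) := by
  subst h'
  induction as₁ generalizing X ds with
  | nil =>
    obtain rfl : es = ds := by simpa using k'
    rw [actSplit_nil]
    exact (post_id _).trans (congrArg (fun y => tensList k y (.ones M.one as₂)) (tensList_nil _
      _).symm)
  | cons a as₁ ih =>
    have k₁ : cs = (ds ++ [a]) ++ (as₁ ++ as₂) := by rw [h]; simp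
    have k₂ : es = (ds ++ [a]) ++ as₁ := by rw [k']; simp
    have e₁ := tensList_cons (es := ds ++ [a]) h x (as₁ := [a]) rfl (M.one a)
      (.ones M.one (as₁ ++ as₂)) k₁ rfl
    have e₂ := tensList_cons (es := ds ++ [a]) k' x (as₁ := [a]) rfl (M.one a)
      (.ones M.one as₁) k₂ rfl
    exact (congrArg (post _) e₁).trans ((ih (tens rfl x (M.one a)) k₂ k₁).trans
      (congrArg (fun y => tensList k y (.ones M.one as₂)) e₂.symm))

/-- The multimap `as ⟶ b` corresponding to a morphism `((i ⊗ a₁) ⊗ ⋯) ⊗ aₙ ⟶ b`. -/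
noncomputable def ofMultiHom {as : List M.Obj} {b : M.Obj} (f : MultiHom as b) : M.Hom as b :=
  post f (unitSpine as)

/-- The list of multimaps corresponding to a list of morphisms. -/
noncomputable def ofHomList : ∀ {as bs : List M.Obj}, HomList (MultiHom (C := M.Obj)) as bs →
    HomList M.Hom as bs
  | _, _, .nil => .nil
  | _, _, .cons h f fs => .cons h (ofMultiHom f) (ofHomList fs)

/-- The formal action of a list agrees with genuine substitution in `M`; with `x` the nullary
universal multimap, this is compatibility of `ofMultiHom` with substitution. -/
theorem post_actList {as bs cs ds : List M.Obj} {X : M.Obj} (h : cs = ds ++ as)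
    (x : M.Hom ds X) (fs : HomList (MultiHom (C := M.Obj)) as bs) :
    post (actList X fs) (tensList h x (.ones M.one as)) = tensList h x (ofHomList fs) := by
  induction fs generalizing X ds with
  | nil => exact post_id _
  | @cons as as₁ as₂ b bs h' f fs ih =>
    have k : cs = (ds ++ as₁) ++ as₂ := by rw [h, h', List.append_assoc]
    rw [actList_cons, post_comp, post_comp, post_actSplit h x h' k rfl, post_actMap, post_comp,
      post_actUnit, post_tensor, post_id, ofHomList, tensList_cons h x h' _ _ k rfl]
    exact ih k (tens rfl x (ofMultiHom f))

theorem ofMultiHom_comp {as bs : List M.Obj} {c : M.Obj} (g : MultiHom bs c)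
    (fs : HomList (MultiHom (C := M.Obj)) as bs) :
    ofMultiHom (actList unit fs ≫ g) = M.comp (ofMultiHom g) (ofHomList fs) := by
  have : M.comp (ofMultiHom g) (ofHomList fs) = post g (M.comp (unitSpine bs) (ofHomList fs)) :=
    M.comp_single_assoc (c := act unit bs) g (unitSpine bs) (ofHomList fs)
  rw [this, comp_unitSpine, ofMultiHom, post_comp, unitSpine, post_actList]

theorem ofMultiHom_lam (a : M.Obj) : ofMultiHom (as := [a]) (lam a) = M.one a := by
  have e : unitSpine [a] = tens (as₁ := []) rfl nullary (M.one a) :=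
    (tensList_cons (es := [a]) rfl nullary (as₁ := [a]) rfl (M.one a) .nil rfl rfl).trans
      (tensList_nil _ _)
  rw [ofMultiHom, e]
  exact post_lamPair rfl (M.one a)

theorem ofMultiHom_bijective (as : List M.Obj) (b : M.Obj) :
    Function.Bijective (ofMultiHom : MultiHom as b → M.Hom as b) :=
  unitSpine_isLeftUniversal as [] as (List.append_nil as).symm b

end Multicategory

end SkewMult

/-! ### Every left representable multicategory comes from a left normal skew monoidal category -/

namespace SkewMult

open CategoryTheory SkewMonoidal

namespace Multicategory

theorem IsLeftRepresentable.nonempty_universalPairs {M : Multicategory.{v, u}}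
    (hM : M.IsLeftRepresentable) : Nonempty (UniversalPairs M) := by
  rw [isLeftRepresentable_iff] at hM
  have key (as : List M.Obj) : ∃ (m : M.Obj) (θ : M.Hom as m), IsLeftUniversal θ := by
    obtain ⟨m, θ, hθ⟩ := hM.1 as
    exact ⟨m, θ, .of_precomp (hM.2 as m θ hθ)⟩
  choose m θ hθ using key
  exact ⟨{
    tensorObj := fun a b => m [a, b]
    pair := fun a b => θ [a, b]
    unitObj := m []
    nullary := θ []
    pair_isLeftUniversal := fun a b => hθ [a, b]
    nullary_isLeftUniversal := hθ [] }⟩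

variable (M : Multicategory.{v, u}) [UniversalPairs M]

/-- The skew monoidal category of unary multimaps. -/
noncomputable def unaryCat : SkewMonCat.{v, u} where
  carrier := M.Obj

theorem unaryCat_isLeftNormal : M.unaryCat.IsLeftNormal :=
  lam_isIso (M := M)

variable {M}

/-- The inverse of `ofMultiHom`. -/
noncomputable def toMultiHom {as : List M.Obj} {b : M.Obj} (f : M.Hom as b) : MultiHom as b :=
  (Equiv.ofBijective _ (ofMultiHom_bijective as b)).symm f

theorem ofMultiHom_toMultiHom {as : List M.Obj} {b : M.Obj} (f : M.Hom as b) :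
    ofMultiHom (toMultiHom f) = f :=
  (Equiv.ofBijective _ (ofMultiHom_bijective as b)).apply_symm_apply f

theorem toMultiHom_ofMultiHom {as : List M.Obj} {b : M.Obj} (f : MultiHom as b) :
    toMultiHom (ofMultiHom f) = f :=
  (Equiv.ofBijective _ (ofMultiHom_bijective as b)).symm_apply_apply f

/-- The inverse of `ofHomList`. -/
noncomputable def toHomList :
    ∀ {as bs : List M.Obj}, HomList M.Hom as bs → HomList (MultiHom (C := M.Obj)) as bs
  | _, _, .nil => .nil
  | _, _, .cons h f fs => .cons h (toMultiHom f) (toHomList fs)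

theorem ofHomList_toHomList {as bs : List M.Obj} (fs : HomList M.Hom as bs) :
    ofHomList (toHomList fs) = fs := by
  induction fs with
  | nil => rfl
  | cons h f fs ih => rw [toHomList, ofHomList, ofMultiHom_toMultiHom, ih]

theorem toMultiHom_comp {as bs : List M.Obj} {c : M.Obj} (g : M.Hom bs c)
    (fs : HomList M.Hom as bs) :
    toMultiHom (M.comp g fs) = actList unit (toHomList fs) ≫ toMultiHom g := by
  apply (ofMultiHom_bijective as c).1
  rw [ofMultiHom_comp, ofMultiHom_toMultiHom, ofMultiHom_toMultiHom, ofHomList_toHomList]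

theorem toMultiHom_one (a : M.Obj) : toMultiHom (M.one a) = (lam a : MultiHom [a] a) := by
  rw [← ofMultiHom_lam, toMultiHom_ofMultiHom]

variable (M)

/-- The comparison from the multicategory of the skew monoidal category of unary multimaps. -/
noncomputable def fromUnaryCat : toMulticategory M.unaryCat ⟶ M where
  obj (a : M.Obj) := a
  -- Although objects are unchanged, `as.map (fun a => a)` equals `as` only propositionally, hence
  -- the cast.
  map {as b} f := M.castDom (as := as) (List.map_id' _).symm (ofMultiHom (M := M) f)
  map_one a := ofMultiHom_lam (M := M) a
  map_comp {as bs c} g fs := by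
    apply eq_of_heq
    refine (M.castDom_heq _ _).trans ((heq_of_eq (ofMultiHom_comp (M := M) g fs)).trans
      (M.comp_heq (List.map_id' _).symm (List.map_id' _).symm rfl (M.castDom_heq _ _).symm ?_))
    clear g
    induction fs with
    | nil => exact HEq.rfl
    | cons h f fs ih =>
      exact HomList.cons_heq (List.map_id' _).symm (List.map_id' _).symm rfl
        (List.map_id' _).symm (M.castDom_heq _ _).symm ih

/-- The comparison to the multicategory of the skew monoidal category of unary multimaps. -/
noncomputable def toUnaryCat : M ⟶ toMulticategory M.unaryCat where
  obj (a : M.Obj) := a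
  map {as b} f := castDom (toMulticategory M.unaryCat) (List.map_id' as).symm (toMultiHom f)
  map_one a := toMultiHom_one a
  map_comp {as bs c} g fs := by
    apply eq_of_heq
    refine (castDom_heq (toMulticategory M.unaryCat) _ _).trans
      ((heq_of_eq (toMultiHom_comp g fs)).trans
      (comp_heq (toMulticategory M.unaryCat) (List.map_id' _).symm (List.map_id' _).symm rfl
        (castDom_heq (toMulticategory M.unaryCat) _ (toMultiHom (M := M) g)).symm ?_))
    clear g
    induction fs with
    | nil => exact HEq.rfl
    | cons h f fs ih =>
      exact HomList.cons_heq (List.map_id' _).symm (List.map_id' _).symm rfl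
        (List.map_id' _).symm (castDom_heq (toMulticategory M.unaryCat) _ (toMultiHom (M := M)
          f)).symm ih

theorem fromUnaryCat_map_heq {as : List M.Obj} {b : M.Obj} (f : MultiHom as b) :
    M.fromUnaryCat.map (as := as) (b := b) f ≍ ofMultiHom f :=
  M.castDom_heq _ _

theorem toUnaryCat_map_heq {as : List M.Obj} {b : M.Obj} (f : M.Hom as b) :
    M.toUnaryCat.map f ≍ toMultiHom f :=
  castDom_heq (toMulticategory M.unaryCat) _ _

theorem fromUnaryCat_toUnaryCat : M.fromUnaryCat ≫ M.toUnaryCat = 𝟙 _ :=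
  MultiFunctor.eq_of rfl fun (as : List M.Obj) (b : M.Obj) (f : MultiHom as b) =>
    (castDom_heq (toMulticategory M.unaryCat) _ _).trans <|
      (M.toUnaryCat.map_heq (List.map_id' as) rfl (M.fromUnaryCat_map_heq f)).trans <|
      (M.toUnaryCat_map_heq (ofMultiHom f)).trans <|
      (heq_of_eq (toMultiHom_ofMultiHom f)).trans
        (castDom_heq (toMulticategory M.unaryCat) _ f).symm

theorem toUnaryCat_fromUnaryCat : M.toUnaryCat ≫ M.fromUnaryCat = 𝟙 _ :=
  MultiFunctor.eq_of rfl fun as _ f =>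
    (M.castDom_heq _ _).trans <|
      (M.fromUnaryCat.map_heq (List.map_id' as) rfl (M.toUnaryCat_map_heq f)).trans <|
      (M.fromUnaryCat_map_heq (toMultiHom f)).trans <|
      (heq_of_eq (ofMultiHom_toMultiHom f)).trans (M.castDom_heq _ f).symm

end Multicategory

end SkewMult

/-! ### Strict 2-functors bijective on cells are 2-equivalences -/

namespace SkewMult

open CategoryTheory SkewMonoidal

open Bicategory

section Strict

variable {B : Type u₁} [Bicategory.{w₁, v₁} B]

theorem whiskerLeft_heq {a b c : B} {f f' : a ⟶ b} {g g' h h' : b ⟶ c} {η : g ⟶ h}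
    {η' : g' ⟶ h'} (ef : f = f') (eg : g = g') (eh : h = h') (e : η ≍ η') :
    f ◁ η ≍ f' ◁ η' := by
  subst ef eg eh
  rw [eq_of_heq e]

theorem whiskerRight_heq {a b c : B} {f f' g g' : a ⟶ b} {h h' : b ⟶ c} {η : f ⟶ g}
    {η' : f' ⟶ g'} (ef : f = f') (eg : g = g') (eh : h = h') (e : η ≍ η') :
    η ▷ h ≍ η' ▷ h' := by
  subst ef eg eh
  rw [eq_of_heq e]

theorem eqToHom_conj_heq {X : Type u} [Category.{v} X] {a a' b b' : X} (f : a ⟶ b)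
    (e : a' = a) (e' : b = b') : eqToHom e ≫ f ≫ eqToHom e' ≍ f := by
  subst e e'
  simp

theorem eq_eqToHom_conj {X : Type u} [Category.{v} X] {a a' b b' : X} {f : a ⟶ b}
    {f' : a' ⟶ b'} (e : a' = a) (e' : b = b') (h : f' ≍ f) :
    f' = eqToHom e ≫ f ≫ eqToHom e' := by
  subst e e'
  simpa using h

theorem comp_eqToHom_eq {X : Type u} [Category.{v} X] {a a' b b' : X} {f : a ⟶ b}
    {f' : a' ⟶ b'} (e : a = a') (e' : b = b') (h : f ≍ f') :
    f ≫ eqToHom e' = eqToHom e ≫ f' := by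
  subst e e'
  simpa using h

variable [Bicategory.Strict B]

/-- In a strict bicategory the coherence isomorphisms are `eqToIso`s, so up to `HEq` they vanish and
whiskering is strictly unital; the next lemmas treat composites alike. -/
theorem id_whiskerLeft_heq {a b : B} {f g : a ⟶ b} (η : f ⟶ g) : 𝟙 a ◁ η ≍ η := by
  rw [id_whiskerLeft, Strict.leftUnitor_eqToIso, Strict.leftUnitor_eqToIso]
  simp only [eqToIso.hom, eqToIso.inv]
  exact eqToHom_conj_heq _ _ _

theorem whiskerRight_id_heq {a b : B} {f g : a ⟶ b} (η : f ⟶ g) : η ▷ 𝟙 b ≍ η := by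
  rw [whiskerRight_id, Strict.rightUnitor_eqToIso, Strict.rightUnitor_eqToIso]
  simp only [eqToIso.hom, eqToIso.inv]
  exact eqToHom_conj_heq _ _ _

theorem comp_whiskerLeft_heq {a b c d : B} (f : a ⟶ b) (g : b ⟶ c) {h h' : c ⟶ d} (η : h ⟶ h') :
    (f ≫ g) ◁ η ≍ f ◁ g ◁ η := by
  rw [comp_whiskerLeft, Strict.associator_eqToIso, Strict.associator_eqToIso]
  simp only [eqToIso.hom, eqToIso.inv]
  exact eqToHom_conj_heq _ _ _

theorem whiskerRight_comp_heq {a b c d : B} {f f' : a ⟶ b} (η : f ⟶ f') (g : b ⟶ c) (h : c ⟶ d) :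
    η ▷ (g ≫ h) ≍ η ▷ g ▷ h := by
  rw [whiskerRight_comp, Strict.associator_eqToIso, Strict.associator_eqToIso]
  simp only [eqToIso.hom, eqToIso.inv]
  exact eqToHom_conj_heq _ _ _

theorem whisker_assoc_heq {a b c d : B} (f : a ⟶ b) {g g' : b ⟶ c} (η : g ⟶ g') (h : c ⟶ d) :
    (f ◁ η) ▷ h ≍ f ◁ η ▷ h := by
  rw [whisker_assoc, Strict.associator_eqToIso, Strict.associator_eqToIso]
  simp only [eqToIso.hom, eqToIso.inv]
  exact eqToHom_conj_heq _ _ _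

theorem whiskerLeft_inv_hom_heq {a b c : B} {f : a ⟶ b} {g : b ⟶ a} (e : f ≫ g = 𝟙 a)
    {h h' : a ⟶ c} (η : h ⟶ h') : f ◁ g ◁ η ≍ η :=
  (comp_whiskerLeft_heq f g η).symm.trans
    ((whiskerLeft_heq e rfl rfl HEq.rfl).trans (id_whiskerLeft_heq η))

theorem whiskerRight_inv_hom_heq {a b c : B} {f : a ⟶ b} {g : b ⟶ a} (e : f ≫ g = 𝟙 a)
    {h h' : c ⟶ a} (η : h ⟶ h') : η ▷ f ▷ g ≍ η :=
  (whiskerRight_comp_heq η f g).symm.trans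
    ((whiskerRight_heq rfl rfl e HEq.rfl).trans (whiskerRight_id_heq η))

variable {C : Type u₂} [Bicategory.{w₂, v₂} C]

theorem map₂_whiskerLeft_heq (T : StrictPseudofunctor B C) {a b c : B} (f : a ⟶ b)
    {g g' : b ⟶ c} (η : g ⟶ g') : T.map₂ (f ◁ η) ≍ T.map f ◁ T.map₂ η := by
  rw [T.map₂_whisker_left, T.mapComp_eq_eqToIso, T.mapComp_eq_eqToIso]
  simp only [eqToIso.hom, eqToIso.inv]
  exact eqToHom_conj_heq _ _ _

theorem map₂_whiskerRight_heq (T : StrictPseudofunctor B C) {a b c : B} {f f' : a ⟶ b}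
    (η : f ⟶ f') (g : b ⟶ c) : T.map₂ (η ▷ g) ≍ T.map₂ η ▷ T.map g := by
  rw [T.map₂_whisker_right, T.mapComp_eq_eqToIso, T.mapComp_eq_eqToIso]
  simp only [eqToIso.hom, eqToIso.inv]
  exact eqToHom_conj_heq _ _ _

end Strict

/-- A 2-functor that is bijective on 1-cells and on 2-cells, together with, for each object of the
target, a strict isomorphism with an object in the image. -/
structure BijectiveTwoFunctor (B : Type u₁) [Bicategory.{w₁, v₁} B]
    (C : Type u₂) [Bicategory.{w₂, v₂} C] extends StrictPseudofunctor B C where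
  map_bijective (a b : B) : Function.Bijective (map : (a ⟶ b) → (obj a ⟶ obj b))
  map₂_bijective {a b : B} (f g : a ⟶ b) :
    Function.Bijective (map₂ : (f ⟶ g) → (map f ⟶ map g))
  objPreimage : C → B
  hom (c : C) : obj (objPreimage c) ⟶ c
  inv (c : C) : c ⟶ obj (objPreimage c)
  hom_inv_id (c : C) : hom c ≫ inv c = 𝟙 (obj (objPreimage c))
  inv_hom_id (c : C) : inv c ≫ hom c = 𝟙 c

namespace BijectiveTwoFunctor

variable {B : Type u₁} [Bicategory.{w₁, v₁} B] {C : Type u₂} [Bicategory.{w₂, v₂} C]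
variable (T : BijectiveTwoFunctor B C)

/-- The preimage of a 1-cell. -/
noncomputable def preimage {a b : B} (f : T.obj a ⟶ T.obj b) : a ⟶ b :=
  ((T.map_bijective a b).2 f).choose

@[simp]
theorem map_preimage {a b : B} (f : T.obj a ⟶ T.obj b) : T.map (T.preimage f) = f :=
  ((T.map_bijective a b).2 f).choose_spec

/-- The preimage of a 2-cell. -/
noncomputable def preimage₂ {a b : B} {f g : a ⟶ b} (η : T.map f ⟶ T.map g) : f ⟶ g :=
  ((T.map₂_bijective f g).2 η).choose

@[simp]
theorem map₂_preimage₂ {a b : B} {f g : a ⟶ b} (η : T.map f ⟶ T.map g) :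
    T.map₂ (T.preimage₂ η) = η :=
  ((T.map₂_bijective f g).2 η).choose_spec

theorem heq_of_map₂_heq [Bicategory.Strict B] {a b : B} {f f' g g' : a ⟶ b} {η : f ⟶ g} {η' : f' ⟶
    g'}
    (ef : f = f') (eg : g = g') (e : T.map₂ η ≍ T.map₂ η') : η ≍ η' := by
  subst ef eg
  exact heq_of_eq ((T.map₂_bijective _ _).1 (eq_of_heq e))

/-- Conjugation of a 1-cell by the chosen isomorphisms. -/
def conj {c d : C} (f : c ⟶ d) : T.obj (T.objPreimage c) ⟶ T.obj (T.objPreimage d) :=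
  T.hom c ≫ f ≫ T.inv d

/-- Conjugation of a 2-cell by the chosen isomorphisms. -/
def conj₂ {c d : C} {f g : c ⟶ d} (η : f ⟶ g) : T.conj f ⟶ T.conj g :=
  T.hom c ◁ η ▷ T.inv d

theorem conj₂_id {c d : C} (f : c ⟶ d) : T.conj₂ (𝟙 f) = 𝟙 _ := by
  rw [conj₂, id_whiskerRight, whiskerLeft_id]
  rfl

theorem conj₂_comp {c d : C} {f g h : c ⟶ d} (η : f ⟶ g) (θ : g ⟶ h) :
    T.conj₂ (η ≫ θ) = T.conj₂ η ≫ T.conj₂ θ := by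
  rw [conj₂, comp_whiskerRight, whiskerLeft_comp]
  rfl

variable [Bicategory.Strict C]

theorem conj_id (c : C) : T.conj (𝟙 c) = 𝟙 _ := by
  rw [conj, Category.id_comp, T.hom_inv_id]

theorem conj_comp {c d e : C} (f : c ⟶ d) (g : d ⟶ e) :
    T.conj (f ≫ g) = T.conj f ≫ T.conj g := by
  simp only [conj, Category.assoc]
  rw [← Category.assoc (T.inv d), T.inv_hom_id, Category.id_comp]

theorem conj_hom {c d : C} (f : c ⟶ d) : T.conj f ≫ T.hom d = T.hom c ≫ f := by
  rw [conj, Category.assoc, Category.assoc, T.inv_hom_id, Category.comp_id]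

theorem inv_conj {c d : C} (f : c ⟶ d) : T.inv c ≫ T.conj f = f ≫ T.inv d := by
  rw [conj, ← Category.assoc, T.inv_hom_id, Category.id_comp]

theorem conj₂_hom_heq {c d : C} {f g : c ⟶ d} (η : f ⟶ g) :
    T.conj₂ η ▷ T.hom d ≍ T.hom c ◁ η :=
  (whisker_assoc_heq _ _ _).trans (whiskerLeft_heq rfl (by simp [T.inv_hom_id])
    (by simp [T.inv_hom_id]) (whiskerRight_inv_hom_heq (T.inv_hom_id d) η))

theorem inv_conj₂_heq {c d : C} {f g : c ⟶ d} (η : f ⟶ g) :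
    T.inv c ◁ T.conj₂ η ≍ η ▷ T.inv d :=
  whiskerLeft_inv_hom_heq (T.inv_hom_id c) _

theorem conj₂_whiskerLeft_heq {c d e : C} (f : c ⟶ d) {g h : d ⟶ e} (η : g ⟶ h) :
    T.conj₂ (f ◁ η) ≍ T.conj f ◁ T.conj₂ η := by
  refine (whiskerLeft_heq rfl (Category.assoc _ _ _) (Category.assoc _ _ _)
    (whisker_assoc_heq f η (T.inv e))).trans ?_
  -- The cancelling pair of chosen isomorphisms at the middle object `d` is inserted by writing `η ▷
  -- T.inv e` as `T.inv d ◁ T.conj₂ η`.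
  refine (whiskerLeft_heq rfl ?_ ?_ (whiskerLeft_heq rfl ?_ ?_ (T.inv_conj₂_heq η).symm)).trans ?_
  · rw [T.inv_conj]
  · rw [T.inv_conj]
  · rw [T.inv_conj]
  · rw [T.inv_conj]
  · refine HEq.trans ?_ (comp_whiskerLeft_heq (T.hom c) (f ≫ T.inv d) (T.conj₂ η)).symm
    exact whiskerLeft_heq rfl (Category.assoc _ _ _).symm (Category.assoc _ _ _).symm
      (comp_whiskerLeft_heq f (T.inv d) (T.conj₂ η)).symm

theorem conj₂_whiskerRight_heq {c d e : C} {f g : c ⟶ d} (η : f ⟶ g) (h : d ⟶ e) :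
    T.conj₂ (η ▷ h) ≍ T.conj₂ η ▷ T.conj h := by
  have h₁ : T.conj₂ η ▷ T.conj h ≍ T.conj₂ η ▷ T.hom d ▷ (h ≫ T.inv e) :=
    whiskerRight_comp_heq _ _ _
  refine HEq.trans ?_ (h₁.trans (whiskerRight_heq (T.conj_hom f) (T.conj_hom g) rfl
    (T.conj₂_hom_heq η))).symm
  refine HEq.trans ?_ (whisker_assoc_heq _ _ _).symm
  exact whiskerLeft_heq rfl (Category.assoc _ _ _) (Category.assoc _ _ _)
    (whiskerRight_comp_heq η h (T.inv e)).symm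

/-- The action of the inverse 2-functor on 2-cells. -/
noncomputable def inverseMap₂ {c d : C} {f g : c ⟶ d} (η : f ⟶ g) :
    T.preimage (T.conj f) ⟶ T.preimage (T.conj g) :=
  T.preimage₂ (eqToHom (T.map_preimage _) ≫ T.conj₂ η ≫ eqToHom (T.map_preimage _).symm)

theorem map₂_inverseMap₂_heq {c d : C} {f g : c ⟶ d} (η : f ⟶ g) :
    T.map₂ (T.inverseMap₂ η) ≍ T.conj₂ η := by
  rw [inverseMap₂, map₂_preimage₂]
  exact eqToHom_conj_heq _ _ _

theorem inverse_map_comp {c d e : C} (f : c ⟶ d) (g : d ⟶ e) :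
    T.preimage (T.conj (f ≫ g)) = T.preimage (T.conj f) ≫ T.preimage (T.conj g) := by
  apply (T.map_bijective _ _).1
  rw [T.map_comp]
  simp [conj_comp]

variable [Bicategory.Strict B]

/-- The inverse 2-functor. -/
noncomputable def inverse : StrictPseudofunctor C B :=
  StrictPseudofunctor.mk'' {
    obj := T.objPreimage
    map f := T.preimage (T.conj f)
    map₂ := T.inverseMap₂
    map₂_id f := by
      apply (T.map₂_bijective _ _).1
      rw [inverseMap₂, map₂_preimage₂, T.map₂_id, conj₂_id]
      simp
    map₂_comp η θ := by
      apply (T.map₂_bijective _ _).1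
      rw [inverseMap₂, map₂_preimage₂, T.map₂_comp, inverseMap₂, inverseMap₂, map₂_preimage₂,
        map₂_preimage₂, conj₂_comp]
      simp
    map_id c := by
      apply (T.map_bijective _ _).1
      rw [T.map_id]
      simp [conj_id]
    map_comp := T.inverse_map_comp
    map₂_whisker_left {c d e} f g g' η := by
      refine eq_eqToHom_conj _ _ (T.heq_of_map₂_heq (T.inverse_map_comp _ _)
        (T.inverse_map_comp _ _) ?_)
      refine (T.map₂_inverseMap₂_heq _).trans ((T.conj₂_whiskerLeft_heq f η).trans
        (HEq.symm ((map₂_whiskerLeft_heq _ _ _).trans ?_)))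
      exact whiskerLeft_heq (T.map_preimage _) (T.map_preimage _) (T.map_preimage _)
        (T.map₂_inverseMap₂_heq η)
    map₂_whisker_right η g := by
      refine eq_eqToHom_conj _ _ (T.heq_of_map₂_heq (T.inverse_map_comp _ _)
        (T.inverse_map_comp _ _) ?_)
      refine (T.map₂_inverseMap₂_heq _).trans ((T.conj₂_whiskerRight_heq η g).trans
        (HEq.symm ((map₂_whiskerRight_heq _ _ _).trans ?_)))
      exact whiskerRight_heq (T.map_preimage _) (T.map_preimage _) (T.map_preimage _)
        (T.map₂_inverseMap₂_heq η) }

theorem unit_naturality {a b : B} (f : a ⟶ b) :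
    f ≫ T.preimage (T.inv (T.obj b)) =
      T.preimage (T.inv (T.obj a)) ≫ T.preimage (T.conj (T.map f)) := by
  apply (T.map_bijective _ _).1
  rw [T.map_comp, T.map_comp]
  simp [inv_conj]

/-- A 2-functor that is bijective on 1-cells and 2-cells and essentially surjective on objects
up to strict isomorphism is part of a 2-equivalence. -/
noncomputable def twoEquivalence : TwoEquivalence B C where
  functor := T.toStrictPseudofunctor
  inverse := T.inverse
  unitIso :=
    -- The chosen isomorphism lives between images under `T`, so it and its inverse are lifted along
    -- the bijection on 1-cells; the laws follow from injectivity.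
    { hom := fun b => T.preimage (T.inv (T.obj b))
      inv := fun b => T.preimage (T.hom (T.obj b))
      hom_inv_id := fun b => by
        apply (T.map_bijective _ _).1
        refine (T.map_comp _ _).trans (Eq.trans ?_ (T.map_id _).symm)
        refine (congrArg₂ (· ≫ ·) (T.map_preimage _) (T.map_preimage _)).trans ?_
        exact T.inv_hom_id _
      inv_hom_id := fun b => by
        apply (T.map_bijective _ _).1
        refine (T.map_comp _ _).trans (Eq.trans ?_ (T.map_id _).symm)
        refine (congrArg₂ (· ≫ ·) (T.map_preimage _) (T.map_preimage _)).trans ?_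
        exact T.hom_inv_id _
      naturality := T.unit_naturality
      naturality₂ := fun {a b f g} η => by
        refine comp_eqToHom_eq _ _ (T.heq_of_map₂_heq (T.unit_naturality f) (T.unit_naturality g)
          ?_)
        refine (map₂_whiskerRight_heq _ _ _).trans
          (HEq.trans ?_ (map₂_whiskerLeft_heq _ _ _).symm)
        refine (whiskerRight_heq rfl rfl (T.map_preimage _) HEq.rfl).trans
          ((T.inv_conj₂_heq (T.map₂ η)).symm.trans ?_)
        exact (whiskerLeft_heq (T.map_preimage _) (T.map_preimage _) (T.map_preimage _)
          (T.map₂_inverseMap₂_heq (T.map₂ η))).symm }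
  counitIso :=
    { hom := T.hom
      inv := T.inv
      hom_inv_id := T.hom_inv_id
      inv_hom_id := T.inv_hom_id
      naturality := fun f =>
        (congrArg (· ≫ _) (T.map_preimage _)).trans (T.conj_hom f)
      naturality₂ := fun {c d f g} η => by
        refine comp_eqToHom_eq _ _ ?_
        exact (whiskerRight_heq (T.map_preimage _) (T.map_preimage _) rfl
          (T.map₂_inverseMap₂_heq η)).trans (T.conj₂_hom_heq η) }

end BijectiveTwoFunctor

end SkewMult

/-! ### Assembling the 2-functor and the 2-equivalence -/

namespace SkewMult

open CategoryTheory SkewMonoidal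

open Bicategory

theorem MultiTrans.heq_of_app {M N : Multicategory.{v, u}} {F F' G G' : M ⟶ N} {φ : F ⟶ G}
    {φ' : F' ⟶ G'} (eF : F = F') (eG : G = G') (h : ∀ a, φ.app a ≍ φ'.app a) : φ ≍ φ' := by
  subst eF eG
  exact heq_of_eq (Multicategory.hom₂_ext fun a => eq_of_heq (h a))

/-- The prelax functor sending a skew monoidal category to its multicategory. -/
def multicategoryPrelax : PrelaxFunctor SkewMonCat.{v, u} Multicategory.{v, u} where
  obj C := toMulticategory C
  map F := LaxMonFunctor.toMultiFunctor F
  map₂ φ := MonNatTrans.toMultiTrans φ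
  map₂_id {C D} F := by
    refine Multicategory.hom₂_ext fun (a : C.carrier) => ?_
    exact Category.comp_id (lam (F.functor.obj a))
  map₂_comp {C D F G H} φ ψ := by
    refine Multicategory.hom₂_ext fun (a : C.carrier) => ?_
    have e : φ.multiApp a ≫ ψ.trans.app a =
        actList unit (.single (Hom := MultiHom) (φ.multiApp a)) ≫ ψ.multiApp a := by
      rw [actList_single, ψ.multiApp_eq, Category.assoc, reassoc_of% lam_naturality,
        reassoc_of% actUnit_lam]
    exact (Category.assoc _ _ _).symm.trans e

theorem toMultiTrans_whiskerLeft_heq {C D E : SkewMonCat.{v, u}} (F : C ⟶ D) {G H : D ⟶ E}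
    (ψ : G ⟶ H) : (multicategoryPrelax.map₂ (F ◁ ψ)) ≍
      multicategoryPrelax.map F ◁ multicategoryPrelax.map₂ ψ :=
  MultiTrans.heq_of_app (LaxMonFunctor.toMultiFunctor_comp F G)
    (LaxMonFunctor.toMultiFunctor_comp F H) fun _ => HEq.rfl

/-- Unlike left whiskering, the components do not agree by definition: one needs that `H` sends the
unary multimap of a morphism to that of its image. -/
theorem toMultiTrans_whiskerRight_heq {C D E : SkewMonCat.{v, u}} {F G : C ⟶ D} (φ : F ⟶ G)
    (H : D ⟶ E) : (multicategoryPrelax.map₂ (φ ▷ H)) ≍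
      multicategoryPrelax.map₂ φ ▷ multicategoryPrelax.map H :=
  MultiTrans.heq_of_app (LaxMonFunctor.toMultiFunctor_comp F H)
    (LaxMonFunctor.toMultiFunctor_comp G H) fun (a : C.carrier) =>
      (heq_of_eq (LaxMonFunctor.mapMulti_lam H (φ.trans.app a))).symm

theorem inducedBicategory_hom₂_heq {B : Type u₂} {C : Type u₁} [Bicategory.{w₁, v₁} C]
    {F : B → C} {X Y : InducedBicategory C F} {f f' g g' : X ⟶ Y} {η : f ⟶ g} {η' : f' ⟶ g'}
    (ef : f = f') (eg : g = g') (h : η.hom ≍ η'.hom) : η ≍ η' := by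
  subst ef eg
  exact heq_of_eq (InducedBicategory.hom₂_ext (eq_of_heq h))

/-- The left representable multicategory of a left normal skew monoidal category. -/
def leftRepMulticategory (C : LeftNormalSkewMonCat.{v, u}) : LeftRepMulticategory.{v, u} :=
  ⟨toMulticategory C.1, toMulticategory_isLeftRepresentable C.2⟩

open InducedBicategory in
/-- The prelax functor sending a left normal skew monoidal category to its multicategory. -/
def leftRepPrelax : PrelaxFunctor LeftNormalSkewMonCat.{v, u} LeftRepMulticategory.{v, u} where
  obj := leftRepMulticategory
  map F := mkHom (multicategoryPrelax.map F.hom)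
  map₂ φ := mkHom₂ (multicategoryPrelax.map₂ φ.hom)
  map₂_id F := hom₂_ext (multicategoryPrelax.map₂_id F.hom)
  map₂_comp φ ψ := hom₂_ext (multicategoryPrelax.map₂_comp φ.hom ψ.hom)

theorem leftRepPrelax_map_comp {C D E : LeftNormalSkewMonCat.{v, u}} (F : C ⟶ D) (G : D ⟶ E) :
    leftRepPrelax.map (F ≫ G) = leftRepPrelax.map F ≫ leftRepPrelax.map G :=
  InducedBicategory.hom_ext (LaxMonFunctor.toMultiFunctor_comp F.hom G.hom)

/-- The 2-functor sending a left normal skew monoidal category to its multicategory. -/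
def multicategoryTwoFunctor :
    StrictPseudofunctor LeftNormalSkewMonCat.{v, u} LeftRepMulticategory.{v, u} :=
  StrictPseudofunctor.mk'' {
    leftRepPrelax with
    map_id C := InducedBicategory.hom_ext (LaxMonFunctor.toMultiFunctor_id C.1)
    map_comp := leftRepPrelax_map_comp
    map₂_whisker_left F G G' ψ := eq_eqToHom_conj _ _
      (inducedBicategory_hom₂_heq (leftRepPrelax_map_comp F G) (leftRepPrelax_map_comp F G')
        (toMultiTrans_whiskerLeft_heq F.hom ψ.hom))
    map₂_whisker_right {_ _ _ F F'} φ H := eq_eqToHom_conj _ _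
      (inducedBicategory_hom₂_heq (leftRepPrelax_map_comp F H) (leftRepPrelax_map_comp F' H)
        (toMultiTrans_whiskerRight_heq φ.hom H.hom)) }

theorem toMultiFunctor_bijective {C D : SkewMonCat.{v, u}} (hD : D.IsLeftNormal) :
    Function.Bijective
      (LaxMonFunctor.toMultiFunctor : LaxMonFunctor C D → MultiFunctor _ _) := by
  have (a : D.carrier) : IsIso (lam a) := hD a
  exact Function.bijective_iff_has_inverse.2 ⟨fun P => P.toLaxMonFunctor,
    fun F => F.toMultiFunctor_toLaxMonFunctor, fun P => P.toLaxMonFunctor_toMultiFunctor⟩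

theorem toMultiTrans_bijective {C D : SkewMonCat.{v, u}} (F G : LaxMonFunctor C D)
    (hD : D.IsLeftNormal) :
    Function.Bijective (MonNatTrans.toMultiTrans : MonNatTrans F G → _) :=
  ⟨MonNatTrans.toMultiTrans_injective hD, MonNatTrans.toMultiTrans_surjective hD⟩

theorem exists_iso_toMulticategory {M : Multicategory.{v, u}} (hM : M.IsLeftRepresentable) :
    ∃ (C : SkewMonCat.{v, u}) (_ : C.IsLeftNormal) (F : toMulticategory C ⟶ M)
      (G : M ⟶ toMulticategory C), F ≫ G = 𝟙 _ ∧ G ≫ F = 𝟙 _ := by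
  obtain ⟨_⟩ := hM.nonempty_universalPairs
  exact ⟨M.unaryCat, M.unaryCat_isLeftNormal, M.fromUnaryCat, M.toUnaryCat,
    M.fromUnaryCat_toUnaryCat, M.toUnaryCat_fromUnaryCat⟩

open InducedBicategory in
theorem nonempty_bijectiveTwoFunctor : Nonempty
    (BijectiveTwoFunctor LeftNormalSkewMonCat.{v, u} LeftRepMulticategory.{v, u}) := by
  -- Universal multimaps merely exist, so the object part of the inverse 2-functor requires choice.
  choose C hC F G hFG hGF using
    fun M : LeftRepMulticategory.{v, u} => exists_iso_toMulticategory M.2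
  exact ⟨{
    multicategoryTwoFunctor with
    map_bijective := fun C D => by
      have h := toMultiFunctor_bijective (C := C.1) D.2
      refine ⟨fun F G e => hom_ext (h.1 (congrArg Hom.hom e)), fun P => ?_⟩
      obtain ⟨F, hF⟩ := h.2 P.hom
      exact ⟨mkHom F, hom_ext hF⟩
    map₂_bijective := fun {C D} F G => by
      have h := toMultiTrans_bijective F.hom G.hom D.2
      refine ⟨fun φ ψ e => hom₂_ext (h.1 (congrArg Hom₂.hom e)), fun τ => ?_⟩
      obtain ⟨φ, hφ⟩ := h.2 τ.hom
      exact ⟨⟨φ⟩, hom₂_ext hφ⟩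
    objPreimage := fun M => ⟨C M, hC M⟩
    hom := fun M => mkHom (F M)
    inv := fun M => mkHom (G M)
    hom_inv_id := fun M => hom_ext (hFG M)
    inv_hom_id := fun M => hom_ext (hGF M) }⟩

end SkewMult

theorem mainTheorem6 :
    Nonempty (SkewMult.TwoEquivalence
      SkewMult.LeftNormalSkewMonCat.{v, u} SkewMult.LeftRepMulticategory.{v, u}) :=
  SkewMult.nonempty_bijectiveTwoFunctor.map fun T => T.twoEquivalence
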